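/- Let $Z$ and $G$ be discrete, with $G$ a group, let $\alpha$ be an action of $G$ on $C_0(Z)$ by $*$-automorphisms, and let $C_0(Z)$ act faithfully on a Hilbert space $H$. The reduced crossed product $C_0(Z)\rtimes_{\alpha,r}G$ is the norm closure in $B(\ell^2(G,H))$ of the operators $\pi\rtimes\lambda(f)=\sum_{s}\pi(f(s))\lambda_s$, $f\in\ell^1(G,C_0(Z))$, where $(\pi(a)\xi)(s)=\alpha_s^{-1}(a)\xi(s)$ and $(\lambda_r\xi)(s)=\xi(r^{-1}s)$. A central Herz–Schur $(C_0(Z),G,\alpha)$-multiplier is a bounded function $F:G\to CB(C_0(Z))$, each $F(r)$ being the multiplication by an element of the centre of the multiplier algebra of $C_0(Z)$ (so $F(r)(a)(z)=\varphi(z,r)a(z)$ for a function $\varphi$ on $Z\times G$), such that $\pi\rtimes\lambda(f)\mapsto\pi\rtimes\lambda(F\cdot f)$, with $(F\cdot f)(r)=F(r)(f(r))$, extends to a completely bounded map $S_F$ on $C_0(Z)\rtimes_{\alpha,r}G$. The space $\mathfrak S_{\rm cent}(C_0(Z),G,\alpha)$ of these multipliers is normed by $\|F\|_{\rm m}=\|S_F\|_{\rm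 cb}$. Finitely supported functions $\psi$ on $Z\times G$ act on it by $\langle\psi,\varphi\rangle=\sum_{z,s}\psi(z,s)\varphi(z,s)$; let $Q_{\rm cent}(Z,G,\alpha)$ be the completion (that is, the norm closure) of $C_c(Z\times G)$ in the dual space $\mathfrak S_{\rm cent}(C_0(Z),G,\alpha)^*$. For $a\in (C_0(Z)\rtimes_{\alpha,r}G)\otimes K(\ell^2)$ (minimal tensor product) and a normal functional $f$ on the von Neumann tensor product $(C_0(Z)\rtimes_{\alpha,r}G)''\,\overline\otimes\,B(\ell^2)$ put $\omega_{a,f}(F)=f\big((S_F\otimes{\rm id})(a)\big)$. Then $Q_{\rm cent}(Z,G,\alpha)^*=\mathfrak S_{\rm cent}(C_0(Z),G,\alpha)$: the canonical map sending $F$ to the functional $q\mapsto q(F)$ on $Q_{\rm cent}(Z,G,\alpha)$ is an isometric linear isomorphism of $\mathfrak S_{\rm cent}(C_0(Z),G,\alpha)$ onto the Banach dual of $Q_{\rm cent}(Z,G,\alpha)$. Moreover, as subsets of $\mathfrak S_{\rm cent}(C_0(Z),G,\alpha)^*$, $$Q_{\rm cent}(Z,G,\alpha)=\Big\{\omega_{a,f}: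 a\in (C_0(Z)\rtimes_{\alpha,r}G)\otimes K(\ell^2),\ f\in \big((C_0(Z)\rtimes_{\alpha,r}G)''\,\overline\otimes\,B(\ell^2)\big)_*\Big\}.$$ -/

import Mathlib

open scoped TensorProduct ZeroAtInfty InnerProductSpace MultiplierAlgebra Topology

noncomputable section

namespace HerzSchur

/-! ### Hilbert spaces of square-summable families -/

/-- The Hilbert space `ℓ²(I, K) = ℓ²(I) ⊗ K` of square-summable families in `K` indexed by `I`. -/
def L2 (I : Type*) (K : Type*) [NormedAddCommGroup K] : Type _ := lp (fun _ : I => K) 2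

namespace L2

variable {I : Type*} {K : Type*} [NormedAddCommGroup K] [InnerProductSpace ℂ K]

instance : NormedAddCommGroup (L2 I K) :=
  inferInstanceAs (NormedAddCommGroup (lp (fun _ : I => K) 2))

instance : InnerProductSpace ℂ (L2 I K) :=
  inferInstanceAs (InnerProductSpace ℂ (lp (fun _ : I => K) 2))

instance [CompleteSpace K] : CompleteSpace (L2 I K) :=
  inferInstanceAs (CompleteSpace (lp (fun _ : I => K) 2))

/-- The `i`-th coordinate. -/
def coord (i : I) : L2 I K →L[ℂ] K := lp.evalCLM ℂ (fun _ : I => K) 2 i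

/-- The family with the entry `k` at `i` and zeros elsewhere. -/
def single (i : I) : K →L[ℂ] L2 I K :=
  letI := Classical.decEq I
  lp.singleContinuousLinearMap ℂ (fun _ : I => K) 2 i

/-- A square-summable family as an element of `ℓ²(I, K)`. -/
def mk (f : I → K) (hf : Memℓp f 2) : L2 I K := ⟨f, hf⟩

@[simp] lemma coord_mk (f : I → K) (hf : Memℓp f 2) (i : I) : coord i (mk f hf) = f i := rfl

lemma memlp (ξ : L2 I K) : Memℓp (fun i => coord i ξ) 2 := lp.memℓp ξ

@[ext] lemma ext {ξ η : L2 I K} (h : ∀ i, coord i ξ = coord i η) : ξ = η := lp.ext (funext h)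

lemma coord_single [DecidableEq I] (i i' : I) (k : K) :
    coord i' (single i k) = if i' = i then k else 0 := by
  have h : coord i' (single i k) = @Pi.single I (fun _ => K) _ (Classical.decEq I) i k i' :=
    congrFun (@lp.coeFn_single I (fun _ => K) _ (Classical.decEq I) 2 i k) i'
  rw [h]
  rcases eq_or_ne i' i with rfl | hi
  · simp
  · simp [hi]

lemma hasSum_norm_sq (ξ : L2 I K) : HasSum (fun i => ‖coord i ξ‖ ^ 2) (‖ξ‖ ^ 2) := by
  have := lp.hasSum_norm (p := 2) (by simp) (show lp (fun _ : I => K) 2 from ξ)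
  simpa using! this

lemma norm_coord_le (i : I) (ξ : L2 I K) : ‖coord i ξ‖ ≤ ‖ξ‖ :=
  lp.norm_apply_le_norm (E := fun _ : I => K) (by simp) ξ i

lemma norm_single (i : I) (k : K) : ‖single i k‖ = ‖k‖ :=
  @lp.norm_single I (fun _ => K) 2 _ (Classical.decEq I) (by simp) i k

lemma hasSum_single (ξ : L2 I K) : HasSum (fun i => single i (coord i ξ)) ξ :=
  @lp.hasSum_single I (fun _ => K) 2 _ (Classical.decEq I) _ (by simp) ξ

lemma hasSum_inner (ξ η : L2 I K) : HasSum (fun i => ⟪coord i ξ, coord i η⟫_ℂ) ⟪ξ, η⟫_ℂ :=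
  lp.hasSum_inner (𝕜 := ℂ) (G := fun _ : I => K) ξ η

lemma memlp_iff {I K : Type*} [NormedAddCommGroup K] {f : I → K} : Memℓp f 2 ↔ Summable fun i => ‖f i‖ ^ 2 := by
  rw [memℓp_gen_iff (by simp)]
  simp

lemma norm_le_of_coord_le {J L : Type*} [NormedAddCommGroup L] [InnerProductSpace ℂ L]
    {ξ : L2 I K} {η : L2 J L} (e : I ≃ J) {C : ℝ} (hC : 0 ≤ C)
    (h : ∀ i, ‖coord i ξ‖ ≤ C * ‖coord (e i) η‖) : ‖ξ‖ ≤ C * ‖η‖ := by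
  refine le_of_sq_le_sq ?_ (by positivity)
  rw [mul_pow]
  refine hasSum_le (fun i => ?_) ξ.hasSum_norm_sq
    ((e.hasSum_iff.2 η.hasSum_norm_sq).mul_left (C ^ 2))
  rw [Function.comp_apply, ← mul_pow]
  exact pow_le_pow_left₀ (norm_nonneg _) (h i) 2

/-- The diagonal operator `(T ξ)(i) = T_i (ξ i)` of a bounded family of operators. -/
def diagOp (T : I → K →L[ℂ] K) (C : ℝ) (hT : ∀ i, ‖T i‖ ≤ C) : L2 I K →L[ℂ] L2 I K :=
  LinearMap.mkContinuous
    { toFun := fun ξ => mk (fun i => T i (coord i ξ)) <| by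
        refine memlp_iff.2 (Summable.of_nonneg_of_le (fun i => by positivity) (fun i => ?_)
          (ξ.hasSum_norm_sq.summable.mul_left (C ^ 2)))
        rw [← mul_pow]
        exact pow_le_pow_left₀ (norm_nonneg _) ((T i).le_of_opNorm_le (hT i) _) 2
      map_add' := fun ξ η => by ext i; simp
      map_smul' := fun c ξ => by ext i; simp }
    (max C 0) fun ξ => norm_le_of_coord_le (Equiv.refl I) (le_max_right _ _) fun i =>
      ((T i).le_of_opNorm_le (hT i) _).trans
        (mul_le_mul_of_nonneg_right (le_max_left _ _) (norm_nonneg _))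

@[simp] lemma coord_diagOp (T : I → K →L[ℂ] K) (C : ℝ) (hT : ∀ i, ‖T i‖ ≤ C) (ξ : L2 I K) (i : I) :
    coord i (diagOp T C hT ξ) = T i (coord i ξ) := rfl

/-- The permutation operator `(U ξ)(i) = ξ (e i)`. -/
def permOp (e : I ≃ I) : L2 I K →L[ℂ] L2 I K :=
  LinearMap.mkContinuous
    { toFun := fun ξ => mk (fun i => coord (e i) ξ) <|
        memlp_iff.2 ((e.summable_iff (f := fun i => ‖coord i ξ‖ ^ 2)).2 ξ.hasSum_norm_sq.summable)
      map_add' := fun ξ η => by ext i; simp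
      map_smul' := fun c ξ => by ext i; simp }
    1 fun ξ => norm_le_of_coord_le e zero_le_one fun i => by simp

@[simp] lemma coord_permOp (e : I ≃ I) (ξ : L2 I K) (i : I) :
    coord i (permOp e ξ) = coord (e i) ξ := rfl

end L2

/-! ### Completely bounded maps between concretely represented spaces of operators -/

section CompletelyBounded

variable {K : Type*} [NormedAddCommGroup K] [InnerProductSpace ℂ K]

/-- The operator on the Hilbert space `Kⁿ` with operator matrix `x ∈ M_n(B(K))`. -/
def blockOp {n : ℕ} (x : Matrix (Fin n) (Fin n) (K →L[ℂ] K)) : L2 (Fin n) K →L[ℂ] L2 (Fin n) K :=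
  ∑ i, ∑ j, L2.single i ∘L x i j ∘L L2.coord j

lemma blockOp_apply {n : ℕ} (x : Matrix (Fin n) (Fin n) (K →L[ℂ] K)) (ξ : L2 (Fin n) K)
    (i : Fin n) : L2.coord i (blockOp x ξ) = ∑ j, x i j (L2.coord j ξ) := by
  simp only [blockOp, sum_apply, map_sum, ContinuousLinearMap.comp_apply, L2.coord_single]
  rw [Finset.sum_comm]
  simp

lemma blockOp_add {n : ℕ} (x y : Matrix (Fin n) (Fin n) (K →L[ℂ] K)) :
    blockOp (x + y) = blockOp x + blockOp y := by
  ext ξ i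
  simp [blockOp_apply, Finset.sum_add_distrib]

lemma blockOp_smul {n : ℕ} (c : ℂ) (x : Matrix (Fin n) (Fin n) (K →L[ℂ] K)) :
    blockOp (c • x) = c • blockOp x := by
  ext ξ i
  simp [blockOp_apply, Finset.smul_sum]

variable {V : Type*} [AddCommGroup V] [Module ℂ V]

/-- For a space `V` of operators on `K`, embedded by `j : V → B(K)`: the linear map `Φ : V → V`
satisfies `‖Φ_n‖ ≤ C` for all its amplifications `Φ_n : M_n(V) → M_n(V)`, `n ∈ ℕ`, where
`M_n(V) ⊆ M_n(B(K)) = B(Kⁿ)` carries the operator norm. -/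
def CBBound (j : V →ₗ[ℂ] (K →L[ℂ] K)) (Φ : V →ₗ[ℂ] V) (C : ℝ) : Prop :=
  0 ≤ C ∧ ∀ (n : ℕ) (x : Matrix (Fin n) (Fin n) V),
    ‖blockOp (x.map fun v => j (Φ v))‖ ≤ C * ‖blockOp (x.map fun v => j v)‖

/-- Complete boundedness. -/
def IsCB (j : V →ₗ[ℂ] (K →L[ℂ] K)) (Φ : V →ₗ[ℂ] V) : Prop := ∃ C, CBBound j Φ C

/-- The completely bounded norm (meaningful for completely bounded maps only). -/
def cbNorm (j : V →ₗ[ℂ] (K →L[ℂ] K)) (Φ : V →ₗ[ℂ] V) : ℝ := sInf {C | CBBound j Φ C}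

variable {j : V →ₗ[ℂ] (K →L[ℂ] K)} {Φ Ψ : V →ₗ[ℂ] V} {C D : ℝ}

lemma CBBound.add (h : CBBound j Φ C) (h' : CBBound j Ψ D) : CBBound j (Φ + Ψ) (C + D) := by
  refine ⟨add_nonneg h.1 h'.1, fun n x => ?_⟩
  have : (x.map fun v => j ((Φ + Ψ) v)) = (x.map fun v => j (Φ v)) + x.map fun v => j (Ψ v) := by
    ext; simp
  rw [this, blockOp_add, add_mul]
  exact (norm_add_le _ _).trans (add_le_add (h.2 n x) (h'.2 n x))

lemma CBBound.smul (c : ℂ) (h : CBBound j Φ C) : CBBound j (c • Φ) (‖c‖ * C) := by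
  refine ⟨mul_nonneg (norm_nonneg _) h.1, fun n x => ?_⟩
  have : (x.map fun v => j ((c • Φ) v)) = c • (x.map fun v => j (Φ v)) := by
    ext; simp
  rw [this, blockOp_smul, norm_smul, mul_assoc]
  exact mul_le_mul_of_nonneg_left (h.2 n x) (norm_nonneg _)

lemma CBBound.zero : CBBound j (0 : V →ₗ[ℂ] V) 0 := by
  refine ⟨le_rfl, fun n x => ?_⟩
  have : (x.map fun v => j ((0 : V →ₗ[ℂ] V) v)) = (0 : ℂ) • (x.map fun v => j v) := by
    ext; simp
  rw [this, blockOp_smul]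
  simp

lemma cbNorm_nonneg : 0 ≤ cbNorm j Φ := Real.sInf_nonneg fun _ h => h.1

lemma CBBound.cbNorm_le (h : CBBound j Φ C) : cbNorm j Φ ≤ C :=
  csInf_le ⟨0, fun _ h => h.1⟩ h

/-- The infimum defining the completely bounded norm is attained. -/
lemma IsCB.bound (h : IsCB j Φ) : CBBound j Φ (cbNorm j Φ) := by
  refine ⟨cbNorm_nonneg, fun n x => ?_⟩
  rcases (norm_nonneg (blockOp (x.map fun v => j v))).eq_or_lt with h0 | h0
  · obtain ⟨C, hC⟩ := h
    have := hC.2 n x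
    rw [← h0] at this ⊢
    simpa using this
  · rw [← div_le_iff₀ h0]
    exact le_csInf h fun C hC => (div_le_iff₀ h0).2 (hC.2 n x)

lemma IsCB.cbNorm_add_le (h : IsCB j Φ) (h' : IsCB j Ψ) :
    cbNorm j (Φ + Ψ) ≤ cbNorm j Φ + cbNorm j Ψ := (h.bound.add h'.bound).cbNorm_le

lemma IsCB.cbNorm_smul (c : ℂ) (h : IsCB j Φ) : cbNorm j (c • Φ) = ‖c‖ * cbNorm j Φ := by
  refine le_antisymm (h.bound.smul c).cbNorm_le ?_
  rcases eq_or_ne c 0 with rfl | hc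
  · simpa using cbNorm_nonneg
  · have h1 : IsCB j (c • Φ) := ⟨_, h.bound.smul c⟩
    have h2 := (h1.bound.smul c⁻¹).cbNorm_le
    rw [smul_smul, inv_mul_cancel₀ hc, one_smul, norm_inv] at h2
    rwa [← le_inv_mul_iff₀ (norm_pos_iff.2 hc)]

lemma norm_blockOp_one (T : K →L[ℂ] K) :
    ‖blockOp (Matrix.of fun _ _ : Fin 1 => T)‖ = ‖T‖ := by
  have hn : ∀ ξ : L2 (Fin 1) K, ‖ξ‖ = ‖L2.coord 0 ξ‖ := fun ξ => by
    have := ξ.hasSum_norm_sq.unique (hasSum_fintype _)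
    simpa using this
  apply le_antisymm
  · refine ContinuousLinearMap.opNorm_le_bound _ (norm_nonneg _) fun ξ => ?_
    rw [hn, hn, blockOp_apply]
    simpa using T.le_opNorm (L2.coord 0 ξ)
  · refine ContinuousLinearMap.opNorm_le_bound _ (norm_nonneg _) fun k => ?_
    have := (blockOp (Matrix.of fun _ _ : Fin 1 => T)).le_opNorm (L2.single 0 k)
    rw [hn, hn, blockOp_apply] at this
    simpa [L2.coord_single] using this

/-- Completely bounded maps are bounded. -/
lemma CBBound.norm_le (h : CBBound j Φ C) (v : V) : ‖j (Φ v)‖ ≤ C * ‖j v‖ := by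
  have := h.2 1 (Matrix.of fun _ _ => v)
  simpa [Matrix.map, norm_blockOp_one] using this

end CompletelyBounded

/-! ### Tensor products with operators on `ℓ²` -/

section Tensor

/-- The Hilbert space `ℓ²(ℕ)`. -/
abbrev SeqL2 : Type := L2 ℕ ℂ

/-- The Hilbert space tensor product `K ⊗ ℓ²`. -/
def TensorL2 (K : Type*) [NormedAddCommGroup K] [InnerProductSpace ℂ K] : Type _ :=
  UniformSpace.Completion (K ⊗[ℂ] SeqL2)

variable {K : Type*} [NormedAddCommGroup K] [InnerProductSpace ℂ K]

instance : NormedAddCommGroup (TensorL2 K) :=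
  inferInstanceAs (NormedAddCommGroup (UniformSpace.Completion (K ⊗[ℂ] SeqL2)))

instance : InnerProductSpace ℂ (TensorL2 K) :=
  inferInstanceAs (InnerProductSpace ℂ (UniformSpace.Completion (K ⊗[ℂ] SeqL2)))

instance : CompleteSpace (TensorL2 K) :=
  inferInstanceAs (CompleteSpace (UniformSpace.Completion (K ⊗[ℂ] SeqL2)))

/-- The inclusion of the algebraic tensor product in the Hilbert space tensor product. -/
def toTensorL2 : (K ⊗[ℂ] SeqL2) →L[ℂ] TensorL2 K := UniformSpace.Completion.toComplL

lemma denseRange_toTensorL2 : DenseRange (toTensorL2 (K := K)) :=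
  UniformSpace.Completion.denseRange_coe

lemma inner_toTensorL2 (u v : K ⊗[ℂ] SeqL2) : ⟪toTensorL2 u, toTensorL2 v⟫_ℂ = ⟪u, v⟫_ℂ :=
  UniformSpace.Completion.inner_coe u v

/-- The elementary tensor `x ⊗ y ∈ K ⊗ ℓ²`, as a continuous map of `y`. -/
def tmulL2 (x : K) : SeqL2 →L[ℂ] TensorL2 K := toTensorL2 ∘L TensorProduct.mkL ℂ K SeqL2 x

lemma tmulL2_apply (x : K) (y : SeqL2) : tmulL2 x y = toTensorL2 (x ⊗ₜ[ℂ] y) := rfl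

lemma tmulL2_add (x x' : K) (y : SeqL2) : tmulL2 (x + x') y = tmulL2 x y + tmulL2 x' y := by
  simp [tmulL2_apply, TensorProduct.add_tmul]

lemma tmulL2_smul (c : ℂ) (x : K) (y : SeqL2) : tmulL2 (c • x) y = c • tmulL2 x y := by
  rw [tmulL2_apply, ← TensorProduct.smul_tmul', map_smul, tmulL2_apply]

lemma inner_tmulL2 (x x' : K) (y y' : SeqL2) :
    ⟪tmulL2 x y, tmulL2 x' y'⟫_ℂ = ⟪x, x'⟫_ℂ * ⟪y, y'⟫_ℂ := by
  simp [tmulL2_apply, inner_toTensorL2]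

/-- A closed subspace of `K ⊗ ℓ²` containing all elementary tensors is everything. -/
lemma mem_of_tmulL2_mem (S : Submodule ℂ (TensorL2 K)) (hS : IsClosed (S : Set (TensorL2 K)))
    (h : ∀ x y, tmulL2 x y ∈ S) (v : TensorL2 K) : v ∈ S := by
  refine denseRange_toTensorL2.induction_on v hS fun t => ?_
  induction t with
  | zero => simp
  | tmul x y => exact h x y
  | add t t' ht ht' => rw [map_add]; exact S.add_mem ht ht'

lemma tensorOp_ext {S T : TensorL2 K →L[ℂ] TensorL2 K}
    (h : ∀ (x : K) (y : SeqL2), S (tmulL2 x y) = T (tmulL2 x y)) : S = T := by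
  ext v
  exact mem_of_tmulL2_mem (LinearMap.eqLocus S.toLinearMap T.toLinearMap)
    (isClosed_eq S.continuous T.continuous) h v

/-- The operator `T ⊗ b` on `K ⊗ ℓ²`. -/
def tensorOp (T : K →L[ℂ] K) (b : SeqL2 →L[ℂ] SeqL2) : TensorL2 K →L[ℂ] TensorL2 K :=
  (TensorProduct.mapL T b).completion

@[simp] lemma tensorOp_tmulL2 (T : K →L[ℂ] K) (b : SeqL2 →L[ℂ] SeqL2) (x : K) (y : SeqL2) :
    tensorOp T b (tmulL2 x y) = tmulL2 (T x) (b y) :=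
  (TensorProduct.mapL T b).completion_apply_coe (x ⊗ₜ[ℂ] y)

variable (K) in
/-- `(T, b) ↦ T ⊗ b` as a bilinear map. -/
def tensorOpₗ : (K →L[ℂ] K) →ₗ[ℂ] (SeqL2 →L[ℂ] SeqL2) →ₗ[ℂ] (TensorL2 K →L[ℂ] TensorL2 K) :=
  LinearMap.mk₂ ℂ tensorOp
    (fun T S b => tensorOp_ext fun x y => by simp [tmulL2_add])
    (fun c T b => tensorOp_ext fun x y => by simp [tmulL2_smul])
    (fun T b b' => tensorOp_ext fun x y => by simp)
    (fun c T b => tensorOp_ext fun x y => by simp)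

/-- The algebra `K(ℓ²)` of compact operators on `ℓ²`. -/
abbrev CompactL2 : Submodule ℂ (SeqL2 →L[ℂ] SeqL2) := compactOperator (RingHom.id ℂ) SeqL2 SeqL2

/-- The algebraic tensor product `E ⊙ K(ℓ²)`. -/
def AlgTensor (E : Submodule ℂ (K →L[ℂ] K)) : Type _ := E ⊗[ℂ] CompactL2

namespace AlgTensor

variable {E : Submodule ℂ (K →L[ℂ] K)}

instance : AddCommGroup (AlgTensor E) := inferInstanceAs (AddCommGroup (E ⊗[ℂ] CompactL2))

instance : Module ℂ (AlgTensor E) := inferInstanceAs (Module ℂ (E ⊗[ℂ] CompactL2))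

/-- Elementary tensors. -/
def tmul (T : E) (b : CompactL2) : AlgTensor E := (T ⊗ₜ[ℂ] b : E ⊗[ℂ] CompactL2)

/-- The linear map on `E ⊙ K(ℓ²)` given by a bilinear map. -/
def lift {X : Type*} [AddCommGroup X] [Module ℂ X] (β : E →ₗ[ℂ] CompactL2 →ₗ[ℂ] X) :
    AlgTensor E →ₗ[ℂ] X := TensorProduct.lift β

lemma lift_tmul {X : Type*} [AddCommGroup X] [Module ℂ X] (β : E →ₗ[ℂ] CompactL2 →ₗ[ℂ] X)
    (T : E) (b : CompactL2) : lift β (tmul T b) = β T b := rfl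

/-- The linear map `T ⊗ b ↦ Φ(T) ⊗ b`. -/
def map (Φ : E →ₗ[ℂ] E) : AlgTensor E →ₗ[ℂ] AlgTensor E :=
  TensorProduct.map Φ (LinearMap.id : CompactL2 →ₗ[ℂ] CompactL2)

lemma map_tmul (Φ : E →ₗ[ℂ] E) (T : E) (b : CompactL2) : map Φ (tmul T b) = tmul (Φ T) b := rfl

lemma map_add_left (Φ Ψ : E →ₗ[ℂ] E) : map (Φ + Ψ) = map Φ + map Ψ :=
  TensorProduct.map_add_left Φ Ψ LinearMap.id

lemma map_smul_left (c : ℂ) (Φ : E →ₗ[ℂ] E) : map (c • Φ) = c • map Φ :=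
  TensorProduct.map_smul_left c Φ LinearMap.id

lemma induction {p : AlgTensor E → Prop} (zero : p 0) (tmul : ∀ T b, p (tmul T b))
    (add : ∀ t t', p t → p t' → p (t + t')) (t : AlgTensor E) : p t :=
  TensorProduct.induction_on (motive := p) t zero tmul add

end AlgTensor

/-- The canonical map `T ⊗ b ↦ T ⊗ b` from the algebraic tensor product `E ⊙ K(ℓ²)` to
`B(K ⊗ ℓ²)`. -/
def algTensor (E : Submodule ℂ (K →L[ℂ] K)) :
    AlgTensor E →ₗ[ℂ] (TensorL2 K →L[ℂ] TensorL2 K) :=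
  AlgTensor.lift ((tensorOpₗ K).domRestrict₁₂ E CompactL2)

@[simp] lemma algTensor_tmul (E : Submodule ℂ (K →L[ℂ] K)) (T : E) (b : CompactL2) :
    algTensor E (AlgTensor.tmul T b) = tensorOp (T : K →L[ℂ] K) (b : SeqL2 →L[ℂ] SeqL2) := rfl

/-- The minimal tensor product `E ⊗ K(ℓ²)`: the closure of the algebraic tensor product in
`B(K ⊗ ℓ²)`. -/
def MinTensor (E : Submodule ℂ (K →L[ℂ] K)) : Type _ :=
  (LinearMap.range (algTensor E)).topologicalClosure

instance (E : Submodule ℂ (K →L[ℂ] K)) : NormedAddCommGroup (MinTensor E) :=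
  inferInstanceAs (NormedAddCommGroup (LinearMap.range (algTensor E)).topologicalClosure)

instance (E : Submodule ℂ (K →L[ℂ] K)) : NormedSpace ℂ (MinTensor E) :=
  inferInstanceAs (NormedSpace ℂ (LinearMap.range (algTensor E)).topologicalClosure)

instance (E : Submodule ℂ (K →L[ℂ] K)) : CompleteSpace (MinTensor E) :=
  (Submodule.isClosed_topologicalClosure (LinearMap.range (algTensor E))).completeSpace_coe

/-- The inclusion of `E ⊗ K(ℓ²)` in `B(K ⊗ ℓ²)`. -/
def MinTensor.val {E : Submodule ℂ (K →L[ℂ] K)} : MinTensor E →L[ℂ] TensorL2 K →L[ℂ] TensorL2 K :=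
  (LinearMap.range (algTensor E)).topologicalClosure.subtypeL

lemma MinTensor.norm_val {E : Submodule ℂ (K →L[ℂ] K)} (a : MinTensor E) : ‖a.val‖ = ‖a‖ := rfl

/-- The algebraic tensor product as a dense subspace of the minimal one. -/
def toMinTensor (E : Submodule ℂ (K →L[ℂ] K)) : AlgTensor E →ₗ[ℂ] MinTensor E :=
  (algTensor E).codRestrict (LinearMap.range (algTensor E)).topologicalClosure fun t =>
    Submodule.le_topologicalClosure _ (LinearMap.mem_range_self _ t)

lemma val_toMinTensor (E : Submodule ℂ (K →L[ℂ] K)) (t : AlgTensor E) :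
    (toMinTensor E t).val = algTensor E t := rfl

lemma norm_toMinTensor (E : Submodule ℂ (K →L[ℂ] K)) (t : AlgTensor E) :
    ‖toMinTensor E t‖ = ‖algTensor E t‖ := rfl

lemma denseRange_toMinTensor (E : Submodule ℂ (K →L[ℂ] K)) : DenseRange (toMinTensor E) := by
  have h : DenseRange fun t : LinearMap.range (algTensor E) =>
      (⟨t, Submodule.le_topologicalClosure _ t.2⟩ :
        (LinearMap.range (algTensor E)).topologicalClosure) :=
    (denseRange_inclusion_iff subset_closure).2 subset_rfl
  refine h.mono ?_
  rintro _ ⟨⟨_, t, rfl⟩, rfl⟩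
  exact ⟨t, rfl⟩

/-- The amplification `Φ ⊗ id : E ⊗ K(ℓ²) → E ⊗ K(ℓ²)` of a completely bounded map `Φ` on `E`:
the continuous extension of `T ⊗ b ↦ Φ(T) ⊗ b`. -/
def amplify {E : Submodule ℂ (K →L[ℂ] K)} (Φ : E →ₗ[ℂ] E) : MinTensor E →L[ℂ] MinTensor E :=
  LinearMap.extendOfNorm (toMinTensor E ∘ₗ AlgTensor.map Φ) (toMinTensor E)

/-! The extension exists: amplifications of completely bounded maps are bounded. -/

/-- The standard basis vectors of `ℓ²`. -/
def basisL2 (i : ℕ) : SeqL2 := L2.single i 1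

lemma inner_basisL2 (i : ℕ) (y : SeqL2) : ⟪basisL2 i, y⟫_ℂ = L2.coord i y := by
  refine (L2.hasSum_inner (basisL2 i) y).unique ?_
  convert hasSum_ite_eq i (L2.coord i y) using 2 with k
  rw [basisL2, L2.coord_single]
  split_ifs with h
  · subst h; simp
  · simp

/-- The isometry `Kⁿ → K ⊗ ℓ²`, `ξ ↦ ∑ ξ_i ⊗ e_i`. -/
def inclFin (n : ℕ) (ξ : L2 (Fin n) K) : TensorL2 K :=
  ∑ i : Fin n, tmulL2 (L2.coord i ξ) (basisL2 i)

lemma inner_inclFin {n : ℕ} (ξ η : L2 (Fin n) K) : ⟪inclFin n ξ, inclFin n η⟫_ℂ = ⟪ξ, η⟫_ℂ := by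
  rw [(L2.hasSum_inner ξ η).unique (hasSum_fintype _)]
  simp only [inclFin, sum_inner, inner_sum, inner_tmulL2, inner_basisL2]
  simp [basisL2, L2.coord_single, Fin.val_inj]

lemma norm_inclFin {n : ℕ} (ξ : L2 (Fin n) K) : ‖inclFin n ξ‖ = ‖ξ‖ := by
  rw [@norm_eq_sqrt_re_inner ℂ, @norm_eq_sqrt_re_inner ℂ _ _ _ _ ξ, inner_inclFin]

/-- The matrix coefficient `T ⊗ b ↦ b_{ij} T`. -/
def slice (E : Submodule ℂ (K →L[ℂ] K)) (i j : ℕ) : AlgTensor E →ₗ[ℂ] E :=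
  AlgTensor.lift
    (LinearMap.mk₂ ℂ (fun (T : E) (b : CompactL2) =>
        (L2.coord i ((b : SeqL2 →L[ℂ] SeqL2) (basisL2 j)) : ℂ) • T)
      (fun _ _ _ => smul_add _ _ _) (fun c T b => smul_comm _ _ _)
      (fun T b b' => by simp [add_smul]) (fun c T b => by simp [mul_smul]))

lemma slice_tmul (E : Submodule ℂ (K →L[ℂ] K)) (i j : ℕ) (T : E) (b : CompactL2) :
    slice E i j (AlgTensor.tmul T b) = (L2.coord i ((b : SeqL2 →L[ℂ] SeqL2) (basisL2 j)) : ℂ) • T := rfl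

lemma slice_map {E : Submodule ℂ (K →L[ℂ] K)} (Φ : E →ₗ[ℂ] E) (i j : ℕ) (t : AlgTensor E) :
    slice E i j (AlgTensor.map Φ t) = Φ (slice E i j t) := by
  induction t using AlgTensor.induction with
  | zero => simp
  | tmul T b => simp [slice_tmul, AlgTensor.map_tmul]
  | add t t' ht ht' => simp [ht, ht']

/-- The `n × n` upper left corner of an element of `E ⊙ K(ℓ²)`. -/
def corner (E : Submodule ℂ (K →L[ℂ] K)) (n : ℕ) (t : AlgTensor E) :
    Matrix (Fin n) (Fin n) E := Matrix.of fun i j => slice E i j t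

lemma inner_algTensor (E : Submodule ℂ (K →L[ℂ] K)) (t : AlgTensor E) {n : ℕ}
    (ξ η : L2 (Fin n) K) :
    ⟪inclFin n η, algTensor E t (inclFin n ξ)⟫_ℂ =
      ⟪η, blockOp ((corner E n t).map fun v => E.subtype v) ξ⟫_ℂ := by
  rw [(L2.hasSum_inner η _).unique (hasSum_fintype _)]
  simp only [blockOp_apply, inner_sum]
  induction t using AlgTensor.induction with
  | zero => simp [corner]
  | tmul T b =>
    simp only [inclFin, map_sum, algTensor_tmul, tensorOp_tmulL2, sum_inner, inner_sum,
      inner_tmulL2, inner_basisL2, corner, slice_tmul, Matrix.map_apply, Matrix.of_apply,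
      Submodule.subtype_apply, Submodule.coe_smul, smul_apply, inner_smul_right]
    rw [Finset.sum_comm]
    simp only [mul_comm]
  | add t t' ht ht' =>
    simp only [map_add, add_apply, inner_add_right, ht, ht', corner, Matrix.map_apply,
      Matrix.of_apply, Finset.sum_add_distrib]

lemma norm_corner_le (E : Submodule ℂ (K →L[ℂ] K)) (t : AlgTensor E) (n : ℕ) :
    ‖blockOp ((corner E n t).map fun v => E.subtype v)‖ ≤ ‖algTensor E t‖ := by
  refine ContinuousLinearMap.opNorm_le_bound _ (norm_nonneg _) fun ξ => ?_
  set η := blockOp ((corner E n t).map fun v => E.subtype v) ξ with hη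
  have h1 : ‖η‖ * ‖η‖ ≤ ‖η‖ * (‖algTensor E t‖ * ‖ξ‖) := by
    rw [← @inner_self_eq_norm_mul_norm ℂ]
    conv_lhs => rw [hη, ← hη, ← inner_algTensor]
    refine (RCLike.re_le_norm _).trans ((norm_inner_le_norm _ _).trans ?_)
    rw [norm_inclFin]
    refine mul_le_mul_of_nonneg_left ?_ (norm_nonneg _)
    simpa [norm_inclFin] using (algTensor E t).le_opNorm (inclFin n ξ)
  rcases (norm_nonneg η).eq_or_lt with h0 | h0
  · rw [← h0]; positivity
  · exact le_of_mul_le_mul_left h1 h0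

/-- Finitely supported sequences in `K` as vectors of `K ⊗ ℓ²`. -/
def inclFinsupp : (ℕ →₀ K) →ₗ[ℂ] TensorL2 K where
  toFun f := f.sum fun i k => tmulL2 k (basisL2 i)
  map_add' f g := Finsupp.sum_add_index' (fun i => by simp [tmulL2_apply])
    (fun i k k' => tmulL2_add _ _ _)
  map_smul' c f := by
    rw [Finsupp.sum_smul_index' (fun i => by simp [tmulL2_apply])]
    simp [Finsupp.smul_sum, tmulL2_smul]

lemma denseRange_inclFinsupp : DenseRange (inclFinsupp (K := K)) := by
  intro v
  refine mem_of_tmulL2_mem (LinearMap.range (inclFinsupp (K := K))).topologicalClosure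
    (Submodule.isClosed_topologicalClosure _) (fun x y => ?_) v
  refine (Submodule.isClosed_topologicalClosure _).mem_of_tendsto
    ((y.hasSum_single).mapL (tmulL2 x)) (Filter.Eventually.of_forall fun s => ?_)
  refine Submodule.sum_mem _ fun i _ => Submodule.le_topologicalClosure _ ?_
  refine ⟨Finsupp.single i ((L2.coord i y : ℂ) • x), ?_⟩
  have : L2.single i (L2.coord i y) = (L2.coord i y : ℂ) • basisL2 i := by
    rw [basisL2, ← map_smul, smul_eq_mul, mul_one]
  rw [this, map_smul, ← tmulL2_smul]
  simp [inclFinsupp, tmulL2_apply]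

lemma exists_inclFin (f g : ℕ →₀ K) : ∃ (n : ℕ) (ξ η : L2 (Fin n) K),
    inclFinsupp f = inclFin n ξ ∧ inclFinsupp g = inclFin n η := by
  obtain ⟨n, hn⟩ := (f.support ∪ g.support).exists_nat_subset_range
  have key : ∀ h : ℕ →₀ K, h.support ⊆ Finset.range n → inclFinsupp h =
      inclFin n (L2.mk (fun i : Fin n => h i) (L2.memlp_iff.2 (hasSum_fintype _).summable)) := by
    intro h hh
    simp only [inclFinsupp, inclFin, LinearMap.coe_mk, AddHom.coe_mk, L2.coord_mk]
    rw [Finsupp.sum_of_support_subset h hh _ (fun i _ => by simp [tmulL2_apply]),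
      Finset.sum_range]
  exact ⟨n, _, _, key f (Finset.union_subset_left hn), key g (Finset.union_subset_right hn)⟩

lemma norm_algTensor_le (E : Submodule ℂ (K →L[ℂ] K)) (t : AlgTensor E) {M : ℝ} (hM : 0 ≤ M)
    (h : ∀ n, ‖blockOp ((corner E n t).map fun v => E.subtype v)‖ ≤ M) : ‖algTensor E t‖ ≤ M := by
  have key : ∀ v u : TensorL2 K, ‖⟪v, algTensor E t u⟫_ℂ‖ ≤ ‖v‖ * (M * ‖u‖) := by
    intro v u
    refine denseRange_inclFinsupp.induction_on₂
      (p := fun v u => ‖⟪v, algTensor E t u⟫_ℂ‖ ≤ ‖v‖ * (M * ‖u‖)) ?_ (fun g f => ?_) v u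
    · exact isClosed_le (by fun_prop) (by fun_prop)
    · obtain ⟨n, ξ, η, hf, hg⟩ := exists_inclFin f g
      rw [hf, hg, inner_algTensor, norm_inclFin, norm_inclFin]
      exact (norm_inner_le_norm _ _).trans (mul_le_mul_of_nonneg_left
        (ContinuousLinearMap.le_of_opNorm_le _ (h n) ξ) (norm_nonneg _))
  refine ContinuousLinearMap.opNorm_le_bound _ hM fun u => ?_
  have h1 := key (algTensor E t u) u
  rw [inner_self_eq_norm_sq_to_K] at h1
  rcases (norm_nonneg (algTensor E t u)).eq_or_lt with h0 | h0
  · rw [← h0]; positivity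
  · refine le_of_mul_le_mul_left (le_trans (le_of_eq ?_) h1) h0
    simp [sq]

lemma CBBound.norm_toMinTensor_le {E : Submodule ℂ (K →L[ℂ] K)} {Φ : E →ₗ[ℂ] E} {C : ℝ}
    (h : CBBound E.subtype Φ C) (t : AlgTensor E) :
    ‖(toMinTensor E ∘ₗ AlgTensor.map Φ) t‖ ≤ C * ‖toMinTensor E t‖ := by
  refine norm_algTensor_le E _ (mul_nonneg h.1 (norm_nonneg _)) fun n => ?_
  have h2 := h.2 n (corner E n t)
  refine le_trans (le_of_eq ?_) (h2.trans (mul_le_mul_of_nonneg_left (norm_corner_le E t n) h.1))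
  congr 2
  ext i j : 2
  simp [corner, slice_map]

lemma CBBound.amplify_apply {E : Submodule ℂ (K →L[ℂ] K)} {Φ : E →ₗ[ℂ] E} {C : ℝ}
    (h : CBBound E.subtype Φ C) (t : AlgTensor E) :
    amplify Φ (toMinTensor E t) = toMinTensor E (AlgTensor.map Φ t) :=
  LinearMap.extendOfNorm_eq (denseRange_toMinTensor E) ⟨C, h.norm_toMinTensor_le⟩ t

lemma CBBound.norm_amplify_le {E : Submodule ℂ (K →L[ℂ] K)} {Φ : E →ₗ[ℂ] E} {C : ℝ}
    (h : CBBound E.subtype Φ C) (a : MinTensor E) : ‖amplify Φ a‖ ≤ C * ‖a‖ :=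
  LinearMap.norm_extendOfNorm_apply_le (denseRange_toMinTensor E) C h.norm_toMinTensor_le a

lemma minTensor_ext {E : Submodule ℂ (K →L[ℂ] K)} {X : Type*} [TopologicalSpace X] [T2Space X]
    {P Q : MinTensor E → X} (hP : Continuous P) (hQ : Continuous Q)
    (h : ∀ t, P (toMinTensor E t) = Q (toMinTensor E t)) : P = Q :=
  (denseRange_toMinTensor E).equalizer hP hQ (funext h)

lemma amplify_add {E : Submodule ℂ (K →L[ℂ] K)} {Φ Ψ : E →ₗ[ℂ] E} (h : IsCB E.subtype Φ)
    (h' : IsCB E.subtype Ψ) (a : MinTensor E) :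
    amplify (Φ + Ψ) a = amplify Φ a + amplify Ψ a := by
  refine congrFun (minTensor_ext (E := E) (P := fun a => amplify (Φ + Ψ) a)
    (Q := fun a => amplify Φ a + amplify Ψ a) (amplify (Φ + Ψ)).continuous
    ((amplify Φ).continuous.add (amplify Ψ).continuous) fun t => ?_) a
  rw [(h.bound.add h'.bound).amplify_apply, h.bound.amplify_apply, h'.bound.amplify_apply,
    AlgTensor.map_add_left, LinearMap.add_apply, map_add]

lemma amplify_smul {E : Submodule ℂ (K →L[ℂ] K)} {Φ : E →ₗ[ℂ] E} (c : ℂ) (h : IsCB E.subtype Φ)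
    (a : MinTensor E) : amplify (c • Φ) a = c • amplify Φ a := by
  refine congrFun (minTensor_ext (E := E) (P := fun a => amplify (c • Φ) a)
    (Q := fun a => c • amplify Φ a) (amplify (c • Φ)).continuous
    ((amplify Φ).continuous.const_smul c) fun t => ?_) a
  rw [(h.bound.smul c).amplify_apply, h.bound.amplify_apply, AlgTensor.map_smul_left,
    LinearMap.smul_apply, (toMinTensor E).map_smul]

end Tensor

/-! ### Bicommutants, von Neumann tensor products, normal functionals -/

section VonNeumann

variable {K : Type*} [NormedAddCommGroup K] [InnerProductSpace ℂ K]

/-- The bicommutant `S''` of a set of operators. -/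
def bicommutant (S : Set (K →L[ℂ] K)) : Subalgebra ℂ (K →L[ℂ] K) :=
  Subalgebra.centralizer ℂ (Subalgebra.centralizer ℂ S : Set (K →L[ℂ] K))

lemma subset_bicommutant (S : Set (K →L[ℂ] K)) : S ⊆ bicommutant S :=
  Set.subset_centralizer_centralizer

lemma isClosed_bicommutant (S : Set (K →L[ℂ] K)) :
    IsClosed (bicommutant S : Set (K →L[ℂ] K)) := Set.isClosed_centralizer _

/-- The von Neumann algebra tensor product `M ⊗̄ B(ℓ²)` of a von Neumann algebra `M` on `K` with
`B(ℓ²)`: the von Neumann algebra on `K ⊗ ℓ²` generated by the operators `T ⊗ b`. -/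
def vnTensor (M : Subalgebra ℂ (K →L[ℂ] K)) : Subalgebra ℂ (TensorL2 K →L[ℂ] TensorL2 K) :=
  bicommutant {x | ∃ T ∈ M, ∃ b : SeqL2 →L[ℂ] SeqL2, x = tensorOp T b}

/-- The ultraweak (σ-weak) topology on `B(K)`: the coarsest topology for which all functionals
`T ↦ ∑ₙ ⟪ξₙ, T ηₙ⟫` with `∑ₙ ‖ξₙ‖² < ∞` and `∑ₙ ‖ηₙ‖² < ∞` are continuous. -/
def ultraweakTopology (K : Type*) [NormedAddCommGroup K] [InnerProductSpace ℂ K] :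
    TopologicalSpace (K →L[ℂ] K) :=
  ⨅ p : L2 ℕ K × L2 ℕ K, TopologicalSpace.induced
    (fun T => ∑' n, ⟪L2.coord n p.1, T (L2.coord n p.2)⟫_ℂ) inferInstance

/-- A bounded functional on a von Neumann algebra is normal, that is, belongs to the predual, if
it is ultraweakly continuous. -/
def IsNormal {N : Subalgebra ℂ (K →L[ℂ] K)} (f : N →L[ℂ] ℂ) : Prop :=
  @Continuous N ℂ ((ultraweakTopology K).induced Subtype.val) inferInstance f

lemma val_mem_vnTensor (E : Submodule ℂ (K →L[ℂ] K)) (a : MinTensor E) :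
    a.val ∈ vnTensor (bicommutant (E : Set (K →L[ℂ] K))) := by
  refine (denseRange_toMinTensor E).induction_on a
    ((isClosed_bicommutant _).preimage MinTensor.val.continuous) fun t => ?_
  rw [val_toMinTensor]
  induction t using AlgTensor.induction with
  | zero => rw [map_zero]; exact zero_mem _
  | tmul T b =>
    exact subset_bicommutant _ ⟨T, subset_bicommutant _ T.2, b, algTensor_tmul E T b⟩
  | add t t' ht ht' => rw [map_add]; exact add_mem ht ht'

/-- The inclusion `E ⊗ K(ℓ²) ⊆ E'' ⊗̄ B(ℓ²)`. -/
def MinTensor.toVN {E : Submodule ℂ (K →L[ℂ] K)} (a : MinTensor E) :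
    vnTensor (bicommutant (E : Set (K →L[ℂ] K))) := ⟨a.val, val_mem_vnTensor E a⟩

lemma MinTensor.norm_toVN {E : Submodule ℂ (K →L[ℂ] K)} (a : MinTensor E) : ‖a.toVN‖ = ‖a‖ := rfl

lemma MinTensor.toVN_add {E : Submodule ℂ (K →L[ℂ] K)} (a b : MinTensor E) :
    (a + b).toVN = a.toVN + b.toVN := rfl

lemma MinTensor.toVN_smul {E : Submodule ℂ (K →L[ℂ] K)} (c : ℂ) (a : MinTensor E) :
    (c • a).toVN = c • a.toVN := rfl

end VonNeumann

/-! ### C*-dynamical systems and Herz–Schur multipliers -/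

/-- A C*-dynamical system `(A, G, α)` with `G` discrete, where the C*-algebra `A` acts faithfully
on the Hilbert space `H`. -/
structure CStarSystem (A G H : Type*) [NonUnitalCStarAlgebra A] [Group G] [NormedAddCommGroup H]
    [InnerProductSpace ℂ H] [CompleteSpace H] where
  /-- The representation of `A` on `H`. -/
  rep : A →⋆ₙₐ[ℂ] (H →L[ℂ] H)
  rep_injective : Function.Injective rep
  /-- The action `α` of `G` on `A` by automorphisms. -/
  action : G →* (A ≃⋆ₐ[ℂ] A)

namespace CStarSystem

variable {A G H : Type*} [NonUnitalCStarAlgebra A] [Group G] [NormedAddCommGroup H]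
  [InnerProductSpace ℂ H] [CompleteSpace H] (D : CStarSystem A G H)

/-- The embedding `A ⊆ B(H)` as a linear map; it makes `A` an operator space. -/
def repₗ : A →ₗ[ℂ] (H →L[ℂ] H) where
  toFun := D.rep
  map_add' := map_add D.rep
  map_smul' := map_smul D.rep

lemma norm_rep_le (a : A) : ‖D.rep a‖ ≤ ‖a‖ := NonUnitalStarAlgHom.norm_apply_le D.rep a

lemma norm_rep (a : A) : ‖D.rep a‖ = ‖a‖ := NonUnitalStarAlgHom.norm_map D.rep D.rep_injective a

lemma norm_action (s : G) (a : A) : ‖D.action s a‖ = ‖a‖ :=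
  NonUnitalStarAlgHom.norm_map (D.action s) (D.action s).injective a

/-- The representation `π` of `A` on `ℓ²(G, H)`: `(π(a)ξ)(s) = α_s⁻¹(a) ξ(s)`. -/
def reprA (a : A) : L2 G H →L[ℂ] L2 G H :=
  L2.diagOp (fun s => D.rep (D.action s⁻¹ a)) ‖a‖ fun _ =>
    (D.norm_rep_le _).trans (D.norm_action _ _).le

/-- The representation `λ` of `G` on `ℓ²(G, H)`: `(λ_r ξ)(s) = ξ(r⁻¹ s)`. -/
def reprG (H : Type*) [NormedAddCommGroup H] [InnerProductSpace ℂ H] (r : G) :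
    L2 G H →L[ℂ] L2 G H := L2.permOp (Equiv.mulLeft r⁻¹)

lemma coord_reprA (a : A) (ξ : L2 G H) (s : G) :
    L2.coord s (D.reprA a ξ) = D.rep (D.action s⁻¹ a) (L2.coord s ξ) := rfl

lemma coord_reprG (r : G) (ξ : L2 G H) (s : G) :
    L2.coord s (reprG H r ξ) = L2.coord (r⁻¹ * s) ξ := rfl

lemma reprA_add (a b : A) : D.reprA (a + b) = D.reprA a + D.reprA b := by
  ext ξ s
  simp [coord_reprA]

lemma reprA_smul (c : ℂ) (a : A) : D.reprA (c • a) = c • D.reprA a := by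
  ext ξ s
  simp [coord_reprA]

lemma norm_reprA_le (a : A) : ‖D.reprA a‖ ≤ ‖a‖ := by
  refine ContinuousLinearMap.opNorm_le_bound _ (norm_nonneg _) fun ξ => ?_
  refine L2.norm_le_of_coord_le (Equiv.refl G) (norm_nonneg _) fun s => ?_
  rw [coord_reprA]
  exact ContinuousLinearMap.le_of_opNorm_le _ ((D.norm_rep_le _).trans (D.norm_action _ _).le) _

lemma norm_reprG_le (r : G) : ‖reprG H r‖ ≤ 1 :=
  ContinuousLinearMap.opNorm_le_bound _ zero_le_one fun ξ =>
    L2.norm_le_of_coord_le (Equiv.mulLeft r⁻¹) zero_le_one fun s => by simp [coord_reprG]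

/-- The Banach space `ℓ¹(G, A)`, as a vector space of functions. -/
def ell1 (G A : Type*) [NonUnitalCStarAlgebra A] : Submodule ℂ (G → A) where
  carrier := {f | Summable fun s => ‖f s‖}
  zero_mem' := by simp
  add_mem' hf hg := (hf.add hg).of_nonneg_of_le (fun _ => norm_nonneg _) fun _ => norm_add_le _ _
  smul_mem' c f hf := by
    simpa [norm_smul] using hf.mul_left ‖c‖

/-- The integrated form `(π ⋊ λ)(f) = ∑ₛ π(f(s)) λ_s`, for `f ∈ ℓ¹(G, A)`; the series converges
absolutely in the operator norm. -/
def integrated (f : G → A) : L2 G H →L[ℂ] L2 G H := ∑' s, D.reprA (f s) * reprG H s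

lemma summable_integrated {f : G → A} (hf : f ∈ ell1 G A) :
    Summable fun s => D.reprA (f s) * reprG H s := by
  refine Summable.of_norm_bounded hf fun s => (norm_mul_le _ _).trans ?_
  exact (mul_le_mul (D.norm_reprA_le _) (norm_reprG_le s) (norm_nonneg _) (norm_nonneg _)).trans
    (mul_one _).le

lemma single_mem_ell1 [DecidableEq G] (r : G) (a : A) : Pi.single r a ∈ ell1 G A :=
  summable_of_ne_finset_zero (s := {r}) fun s hs => by
    have : s ≠ r := by simpa using hs
    simp [this]

lemma integrated_single [DecidableEq G] (r : G) (a : A) :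
    D.integrated (Pi.single r a) = D.reprA a * reprG H r := by
  have h0 : D.reprA 0 = 0 := by simpa using D.reprA_smul 0 0
  rw [integrated, tsum_eq_single r fun s hs => by rw [Pi.single_eq_of_ne hs, h0, zero_mul]]
  simp

lemma norm_reprA_mul (a : A) (r : G) : ‖D.reprA a * reprG H r‖ = ‖a‖ := by
  classical
  refine le_antisymm ((norm_mul_le _ _).trans ((mul_le_mul (D.norm_reprA_le _) (norm_reprG_le r)
    (norm_nonneg _) (norm_nonneg _)).trans (mul_one _).le)) ?_
  rw [← D.norm_rep a]
  refine ContinuousLinearMap.opNorm_le_bound _ (norm_nonneg _) fun k => ?_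
  have h1 : L2.coord 1 ((D.reprA a * reprG H r) (L2.single r⁻¹ k)) = D.rep a k := by
    simp [coord_reprA, coord_reprG, L2.coord_single]
  rw [← h1, ← L2.norm_single (r⁻¹ : G) k]
  exact (L2.norm_coord_le _ _).trans (ContinuousLinearMap.le_opNorm _ _)

/-- The integrated form as a linear map on `ℓ¹(G, A)`. -/
def integratedₗ : ell1 G A →ₗ[ℂ] (L2 G H →L[ℂ] L2 G H) where
  toFun f := D.integrated f
  map_add' f g := by
    rw [integrated, integrated, integrated,
      ← (D.summable_integrated f.2).tsum_add (D.summable_integrated g.2)]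
    simp [reprA_add, add_mul]
  map_smul' c f := by
    simp only [integrated, RingHom.id_apply]
    rw [← (D.summable_integrated f.2).tsum_const_smul c]
    simp [reprA_smul]

/-- The reduced crossed product `A ⋊_{r} G`: the norm closure of `(π ⋊ λ)(ℓ¹(G, A))` in
`B(ℓ²(G, H))`. -/
def crossedProduct : Submodule ℂ (L2 G H →L[ℂ] L2 G H) :=
  (LinearMap.range D.integratedₗ).topologicalClosure

/-- The integrated form with values in the reduced crossed product. -/
def toCrossedProduct : ell1 G A →ₗ[ℂ] D.crossedProduct :=
  D.integratedₗ.codRestrict D.crossedProduct fun f =>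
    Submodule.le_topologicalClosure _ (LinearMap.mem_range_self _ f)

/-- The map `Φ` on the reduced crossed product satisfies
`Φ((π ⋊ λ)(f)) = (π ⋊ λ)(F · f)` for `f ∈ ℓ¹(G, A)`, where `(F · f)(r) = F(r)(f(r))`. -/
def Implements (F : G → A →L[ℂ] A) (Φ : D.crossedProduct →ₗ[ℂ] D.crossedProduct) : Prop :=
  ∀ f : ell1 G A, (Φ (D.toCrossedProduct f) : L2 G H →L[ℂ] L2 G H) =
    D.integrated fun r => F r ((f : G → A) r)

/-- Herz–Schur `(A, G, α)`-multipliers: bounded functions `F : G → CB(A)` for which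
`(π ⋊ λ)(f) ↦ (π ⋊ λ)(F · f)` extends to a completely bounded map on the reduced crossed
product. -/
def IsHerzSchurMultiplier (F : G → A →L[ℂ] A) : Prop :=
  (∃ C, ∀ r, CBBound D.repₗ (F r).toLinearMap C) ∧
    ∃ Φ : D.crossedProduct →ₗ[ℂ] D.crossedProduct,
      IsCB D.crossedProduct.subtype Φ ∧ D.Implements F Φ

/-- `F` is central: every `F(r)` is the multiplication by an element of the centre of the
multiplier algebra of `A`. -/
def IsCentral (F : G → A →L[ℂ] A) : Prop :=
  ∀ r, ∃ m ∈ Subalgebra.center ℂ 𝓜(ℂ, A), F r = m.fst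

variable {D}

lemma mem_ell1_of_bound {F : G → A →L[ℂ] A} {C : ℝ}
    (hF : ∀ r, CBBound D.repₗ (F r).toLinearMap C) {f : G → A} (hf : f ∈ ell1 G A) :
    (fun r => F r (f r)) ∈ ell1 G A := by
  refine Summable.of_nonneg_of_le (fun _ => norm_nonneg _) (fun r => ?_)
    (Summable.mul_left C (show Summable fun r => ‖f r‖ from hf))
  have := (hF r).norm_le (f r)
  rwa [show D.repₗ (f r) = D.rep (f r) from rfl, D.norm_rep, show D.repₗ ((F r).toLinearMap (f r)) =
    D.rep (F r (f r)) from rfl, D.norm_rep] at this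

lemma Implements.add {F F' : G → A →L[ℂ] A} {Φ Φ' : D.crossedProduct →ₗ[ℂ] D.crossedProduct}
    {C C' : ℝ} (hF : ∀ r, CBBound D.repₗ (F r).toLinearMap C)
    (hF' : ∀ r, CBBound D.repₗ (F' r).toLinearMap C')
    (h : D.Implements F Φ) (h' : D.Implements F' Φ') : D.Implements (F + F') (Φ + Φ') := by
  intro f
  rw [LinearMap.add_apply, Submodule.coe_add, h f, h' f]
  exact (D.integratedₗ.map_add ⟨_, mem_ell1_of_bound hF f.2⟩ ⟨_, mem_ell1_of_bound hF' f.2⟩).symm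

lemma Implements.smul {F : G → A →L[ℂ] A} {Φ : D.crossedProduct →ₗ[ℂ] D.crossedProduct}
    {C : ℝ} (hF : ∀ r, CBBound D.repₗ (F r).toLinearMap C) (c : ℂ)
    (h : D.Implements F Φ) : D.Implements (c • F) (c • Φ) := by
  intro f
  rw [LinearMap.smul_apply, Submodule.coe_smul, h f]
  exact (D.integratedₗ.map_smul c ⟨_, mem_ell1_of_bound hF f.2⟩).symm

/-- The map implemented by `F` is determined by `F`. -/
lemma Implements.unique {F : G → A →L[ℂ] A} {Φ Φ' : D.crossedProduct →ₗ[ℂ] D.crossedProduct}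
    (hΦ : IsCB D.crossedProduct.subtype Φ) (hΦ' : IsCB D.crossedProduct.subtype Φ')
    (h : D.Implements F Φ) (h' : D.Implements F Φ') : Φ = Φ' := by
  have hc : ∀ {Ψ : D.crossedProduct →ₗ[ℂ] D.crossedProduct}, IsCB D.crossedProduct.subtype Ψ →
      Continuous Ψ := fun {Ψ} hΨ =>
    (LinearMap.mkContinuous Ψ _ fun x => hΨ.bound.norm_le x).continuous
  have hd : DenseRange fun t : LinearMap.range D.integratedₗ =>
      (⟨t, Submodule.le_topologicalClosure _ t.2⟩ : D.crossedProduct) :=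
    (denseRange_inclusion_iff subset_closure).2 subset_rfl
  apply LinearMap.coe_injective
  refine hd.equalizer (hc hΦ) (hc hΦ') (funext ?_)
  rintro ⟨_, f, rfl⟩
  exact Subtype.ext ((h f).trans (h' f).symm)

variable (D)

/-- The vector space of central Herz–Schur `(A, G, α)`-multipliers. -/
def centralSubmodule : Submodule ℂ (G → A →L[ℂ] A) where
  carrier := {F | D.IsHerzSchurMultiplier F ∧ IsCentral F}
  zero_mem' := by
    refine ⟨⟨⟨0, fun r => CBBound.zero⟩, 0, ⟨0, CBBound.zero⟩, fun f => ?_⟩, fun r =>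
      ⟨0, zero_mem _, rfl⟩⟩
    exact (D.integratedₗ.map_zero).symm
  add_mem' := by
    rintro F F' ⟨⟨⟨C, hC⟩, Φ, hΦ, hF⟩, hc⟩ ⟨⟨⟨C', hC'⟩, Φ', hΦ', hF'⟩, hc'⟩
    refine ⟨⟨⟨C + C', fun r => (hC r).add (hC' r)⟩, Φ + Φ', ⟨_, hΦ.bound.add hΦ'.bound⟩,
      hF.add hC hC' hF'⟩, fun r => ?_⟩
    obtain ⟨m, hm, h⟩ := hc r
    obtain ⟨m', hm', h'⟩ := hc' r
    exact ⟨m + m', add_mem hm hm', by simp [h, h']⟩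
  smul_mem' := by
    rintro c F ⟨⟨⟨C, hC⟩, Φ, hΦ, hF⟩, hc⟩
    refine ⟨⟨⟨‖c‖ * C, fun r => (hC r).smul c⟩, c • Φ, ⟨_, hΦ.bound.smul c⟩, hF.smul hC c⟩,
      fun r => ?_⟩
    obtain ⟨m, hm, h⟩ := hc r
    exact ⟨c • m, Subalgebra.smul_mem _ hm c, by simp [h]⟩

/-- The space `𝔖_cent(A, G, α)` of central Herz–Schur `(A, G, α)`-multipliers. -/
def CentralMultiplier : Type _ := D.centralSubmodule

namespace CentralMultiplier

variable {D}

instance : AddCommGroup D.CentralMultiplier := inferInstanceAs (AddCommGroup D.centralSubmodule)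

instance : Module ℂ D.CentralMultiplier := inferInstanceAs (Module ℂ D.centralSubmodule)

/-- The underlying function `G → B(A)`. -/
def toFun (F : D.CentralMultiplier) : G → A →L[ℂ] A := F.1

lemma toFun_add (F F' : D.CentralMultiplier) : (F + F').toFun = F.toFun + F'.toFun := rfl

lemma toFun_smul (c : ℂ) (F : D.CentralMultiplier) : (c • F).toFun = c • F.toFun := rfl

lemma cb_bound (F : D.CentralMultiplier) : ∃ C, ∀ r, CBBound D.repₗ (F.toFun r).toLinearMap C :=
  F.2.1.1

/-- The completely bounded map `S_F` on the reduced crossed product. -/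
def S (F : D.CentralMultiplier) : D.crossedProduct →ₗ[ℂ] D.crossedProduct := F.2.1.2.choose

lemma isCB_S (F : D.CentralMultiplier) : IsCB D.crossedProduct.subtype F.S :=
  F.2.1.2.choose_spec.1

lemma implements_S (F : D.CentralMultiplier) : D.Implements F.toFun F.S :=
  F.2.1.2.choose_spec.2

lemma S_add (F F' : D.CentralMultiplier) : (F + F').S = F.S + F'.S := by
  obtain ⟨C, hC⟩ := F.cb_bound
  obtain ⟨C', hC'⟩ := F'.cb_bound
  exact (F + F').implements_S.unique (F + F').isCB_S ⟨_, F.isCB_S.bound.add F'.isCB_S.bound⟩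
    (F.implements_S.add hC hC' F'.implements_S)

lemma S_smul (c : ℂ) (F : D.CentralMultiplier) : (c • F).S = c • F.S := by
  obtain ⟨C, hC⟩ := F.cb_bound
  exact (c • F).implements_S.unique (c • F).isCB_S ⟨_, F.isCB_S.bound.smul c⟩
    (F.implements_S.smul hC c)

/-- The norm `‖F‖_m = ‖S_F‖_cb`. -/
instance : Norm D.CentralMultiplier := ⟨fun F => cbNorm D.crossedProduct.subtype F.S⟩

lemma norm_def (F : D.CentralMultiplier) : ‖F‖ = cbNorm D.crossedProduct.subtype F.S := rfl

lemma norm_S_le (F : D.CentralMultiplier) (x : D.crossedProduct) : ‖F.S x‖ ≤ ‖F‖ * ‖x‖ :=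
  F.isCB_S.bound.norm_le x

/-- The values of a multiplier are bounded by its norm. -/
lemma norm_toFun_le (F : D.CentralMultiplier) (r : G) (a : A) : ‖F.toFun r a‖ ≤ ‖F‖ * ‖a‖ := by
  classical
  have h1 : (F.S (D.toCrossedProduct ⟨Pi.single r a, single_mem_ell1 r a⟩) :
      L2 G H →L[ℂ] L2 G H) = D.reprA (F.toFun r a) * reprG H r := by
    rw [F.implements_S, ← D.integrated_single]
    congr 1
    ext s
    rcases eq_or_ne s r with rfl | h
    · simp
    · simp [h]
  have h2 := F.norm_S_le (D.toCrossedProduct ⟨Pi.single r a, single_mem_ell1 r a⟩)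
  rw [Submodule.coe_norm, h1, Submodule.coe_norm,
    show (D.toCrossedProduct ⟨Pi.single r a, single_mem_ell1 r a⟩ : L2 G H →L[ℂ] L2 G H) =
      D.reprA a * reprG H r from D.integrated_single r a, D.norm_reprA_mul, D.norm_reprA_mul] at h2
  exact h2

instance : NormedAddCommGroup D.CentralMultiplier :=
  NormedAddCommGroup.ofCore (𝕜 := ℂ)
    { norm_nonneg := fun F => cbNorm_nonneg
      norm_smul := fun c F => by
        rw [norm_def, S_smul, F.isCB_S.cbNorm_smul, norm_def]
      norm_triangle := fun F F' => by
        rw [norm_def, S_add]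
        exact F.isCB_S.cbNorm_add_le F'.isCB_S
      norm_eq_zero_iff := fun F => by
        constructor
        · intro h
          refine Subtype.ext (funext fun r => ContinuousLinearMap.ext fun a => ?_)
          have := F.norm_toFun_le r a
          rw [h, zero_mul] at this
          exact norm_le_zero_iff.1 this
        · rintro rfl
          have h0 : (0 : D.CentralMultiplier).S = 0 := by
            simpa using S_smul (0 : ℂ) (0 : D.CentralMultiplier)
          rw [norm_def, h0]
          exact le_antisymm CBBound.zero.cbNorm_le cbNorm_nonneg }

instance : NormedSpace ℂ D.CentralMultiplier where
  norm_smul_le c F := by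
    rw [norm_def, S_smul, F.isCB_S.cbNorm_smul, norm_def]

end CentralMultiplier

/-- The functional `ω_{a,f}(F) = f((S_F ⊗ id)(a))` on the central multipliers, for
`a ∈ (A ⋊_r G) ⊗ K(ℓ²)` and a bounded functional `f` on `(A ⋊_r G)'' ⊗̄ B(ℓ²)`. -/
def omega (a : MinTensor D.crossedProduct)
    (f : vnTensor (bicommutant (D.crossedProduct : Set (L2 G H →L[ℂ] L2 G H))) →L[ℂ] ℂ) :
    StrongDual ℂ D.CentralMultiplier :=
  LinearMap.mkContinuous
    { toFun := fun F => f (amplify F.S a).toVN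
      map_add' := fun F F' => by
        rw [F.S_add, amplify_add F.isCB_S F'.isCB_S, MinTensor.toVN_add, map_add]
      map_smul' := fun c F => by
        rw [F.S_smul, amplify_smul c F.isCB_S, MinTensor.toVN_smul, map_smul, RingHom.id_apply] }
    (‖f‖ * ‖a‖) fun F => by
      refine (f.le_opNorm _).trans ?_
      rw [MinTensor.norm_toVN, mul_assoc, mul_comm ‖a‖]
      exact mul_le_mul_of_nonneg_left (F.isCB_S.bound.norm_amplify_le a) (norm_nonneg _)

end CStarSystem

/-! ### The predual for discrete transformation systems -/

section Discrete

variable {Z G H : Type*} [TopologicalSpace Z] [DiscreteTopology Z] [Group G]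
  [NormedAddCommGroup H] [InnerProductSpace ℂ H] [CompleteSpace H]

/-- The function `δ_z ∈ C₀(Z)`, for discrete `Z`. -/
def delta (z : Z) : C₀(Z, ℂ) where
  toFun := Set.indicator {z} 1
  continuous_toFun := continuous_of_discreteTopology
  zero_at_infty' := by
    refine tendsto_const_nhds.congr' ?_
    filter_upwards [(isCompact_singleton (x := z)).compl_mem_cocompact] with w hw
    exact (Set.indicator_of_notMem hw _).symm

lemma norm_delta_le (z : Z) : ‖delta z‖ ≤ 1 := by
  rw [← ZeroAtInftyContinuousMap.norm_toBCF_eq_norm,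
    BoundedContinuousFunction.norm_le zero_le_one]
  intro w
  change ‖Set.indicator {z} (1 : Z → ℂ) w‖ ≤ 1
  by_cases h : w ∈ ({z} : Set Z) <;> simp [h]

lemma norm_apply_le_norm (a : C₀(Z, ℂ)) (z : Z) : ‖a z‖ ≤ ‖a‖ := by
  rw [← ZeroAtInftyContinuousMap.norm_toBCF_eq_norm]
  exact a.toBCF.norm_coe_le_norm z

variable (D : CStarSystem C₀(Z, ℂ) G H)

/-- Evaluation of the function `φ : Z × G → ℂ` belonging to a central multiplier `F`, that is
`F(s)(a)(z) = φ(z, s) a(z)`. -/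
def evalAt (p : Z × G) : StrongDual ℂ D.CentralMultiplier :=
  LinearMap.mkContinuous
    { toFun := fun F => F.toFun p.2 (delta p.1) p.1
      map_add' := fun F F' => by simp [CStarSystem.CentralMultiplier.toFun_add]
      map_smul' := fun c F => by simp [CStarSystem.CentralMultiplier.toFun_smul] }
    1 fun F => by
      rw [one_mul]
      exact (norm_apply_le_norm _ _).trans ((F.norm_toFun_le p.2 (delta p.1)).trans
        (mul_le_of_le_one_right (norm_nonneg _) (norm_delta_le p.1)))

/-- Finitely supported functions `ψ` on `Z × G` as functionals on the central multipliers: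
`⟨ψ, φ⟩ = ∑ ψ(z, s) φ(z, s)`. -/
def pairing : (Z × G →₀ ℂ) →ₗ[ℂ] StrongDual ℂ D.CentralMultiplier :=
  Finsupp.linearCombination ℂ (evalAt D)

/-- The space `Q_cent(Z, G, α)`: the completion of `C_c(Z × G)` in the dual of the space of
central multipliers, that is, its norm closure there. -/
def Qcent : Type _ := (LinearMap.range (pairing D)).topologicalClosure

instance : NormedAddCommGroup (Qcent D) :=
  inferInstanceAs (NormedAddCommGroup (LinearMap.range (pairing D)).topologicalClosure)

instance : NormedSpace ℂ (Qcent D) :=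
  inferInstanceAs (NormedSpace ℂ (LinearMap.range (pairing D)).topologicalClosure)

/-- The inclusion of `Q_cent(Z, G, α)` in the dual of the space of central multipliers. -/
def Qcent.toDual : Qcent D →L[ℂ] StrongDual ℂ D.CentralMultiplier :=
  (LinearMap.range (pairing D)).topologicalClosure.subtypeL

end Discrete

end HerzSchur
end

open HerzSchur

/-!
A multiplier acts diagonally on the elements `π(δ_z) λ_s`, which generate the crossed product:
`S_F` scales `π(δ_z) λ_s` by `φ(z, s)`. Hence every `ω_{a, f}` is a norm limit of finitely
supported functionals, and lies in `Q_cent(Z, G, α)`.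

Conversely, a functional `Λ` on `𝔖_cent(C₀(Z), G, α)*` defines an operator `Φ(T)` by
`⟪η, Φ(T) ξ⟫ = Λ (F ↦ ⟪η, S_F(T) ξ⟫)`. The map `Φ` is completely bounded by `‖Λ‖` and diagonal,
so it is `S_F` for a central multiplier `F`, and `Λ` is evaluation at `F` on `Q_cent(Z, G, α)`.
This gives the duality.

The vector functionals `F ↦ ⟪η, (S_F ⊗ id)(a) ξ⟫` with `a`, `η`, `ξ` in unit balls norm the
multipliers, and they form a convex balanced set, because two of them can be placed in orthogonal
blocks of `ℓ²`. By Hahn–Banach and the duality this set is dense in the unit ball of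
`Q_cent(Z, G, α)`. So each `q` is the sum of a geometrically convergent series of vector
functionals, and, placed in infinitely many orthogonal blocks, these add up to a single one.
-/

noncomputable section

namespace HerzSchur

/-! ### Functions vanishing at infinity -/

section ZeroAtInfty

variable {Z : Type*} [TopologicalSpace Z]

lemma norm_le_of_forall_apply_le {a : C₀(Z, ℂ)} {C : ℝ} (hC : 0 ≤ C) (h : ∀ z, ‖a z‖ ≤ C) :
    ‖a‖ ≤ C := by
  rw [← ZeroAtInftyContinuousMap.norm_toBCF_eq_norm, BoundedContinuousFunction.norm_le hC]
  exact h

/-- The pointwise multiplication by a bounded continuous function on `C₀(Z)`. -/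
def mulOp (φ : BoundedContinuousFunction Z ℂ) : C₀(Z, ℂ) →L[ℂ] C₀(Z, ℂ) :=
  LinearMap.mkContinuous
    { toFun := fun a =>
        { toFun := fun z => φ z * a z
          continuous_toFun := by fun_prop
          zero_at_infty' := by
            refine squeeze_zero_norm (fun z => (norm_mul_le _ _).trans
              (mul_le_mul_of_nonneg_right (φ.norm_coe_le_norm z) (norm_nonneg _))) ?_
            simpa using (zero_at_infty a).norm.const_mul ‖φ‖ }
      map_add' := fun a b => by ext z; exact mul_add _ _ _
      map_smul' := fun c a => by ext z; exact mul_left_comm _ _ _ }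
    ‖φ‖ fun a => norm_le_of_forall_apply_le (by positivity) fun z => (norm_mul_le _ _).trans
      (mul_le_mul (φ.norm_coe_le_norm z) (a.toBCF.norm_coe_le_norm z) (norm_nonneg _)
        (norm_nonneg _))

lemma mulOp_apply (φ : BoundedContinuousFunction Z ℂ) (a : C₀(Z, ℂ)) (z : Z) :
    mulOp φ a z = φ z * a z := rfl

variable [DiscreteTopology Z]

lemma delta_apply_self (z : Z) : delta z z = 1 := Set.indicator_of_mem (Set.mem_singleton z) _

lemma delta_apply_of_ne {z w : Z} (h : w ≠ z) : delta z w = 0 :=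
  Set.indicator_of_notMem (s := {z}) (f := (1 : Z → ℂ)) h

lemma delta_ne_zero (z : Z) : delta z ≠ 0 := fun h => by
  simpa [delta_apply_self] using DFunLike.congr_fun h z

lemma sum_smul_delta_apply [DecidableEq Z] (T : Finset Z) (c : Z → ℂ) (w : Z) :
    (∑ z ∈ T, c z • delta z) w = if w ∈ T then c w else 0 := by
  induction T using Finset.induction_on with
  | empty => simp
  | insert z S hz ih =>
    rw [Finset.sum_insert hz, ZeroAtInftyContinuousMap.add_apply, ih,
      ZeroAtInftyContinuousMap.smul_apply]
    rcases eq_or_ne w z with rfl | h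
    · simp [hz, delta_apply_self]
    · simp [h, delta_apply_of_ne h]

lemma hasSum_delta (a : C₀(Z, ℂ)) : HasSum (fun z => a z • delta z) a := by
  classical
  rw [HasSum, SummationFilter.unconditional_filter, Metric.tendsto_atTop]
  intro ε hε
  have h0 : ∀ᶠ z in Filter.cofinite, ‖a z‖ < ε / 2 := by
    have := (zero_at_infty a).norm
    rw [Filter.cocompact_eq_cofinite, norm_zero] at this
    exact this.eventually_lt_const (half_pos hε)
  have hfin : {z | ¬ ‖a z‖ < ε / 2}.Finite := h0
  refine ⟨hfin.toFinset, fun T hT => ?_⟩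
  rw [dist_eq_norm]
  refine lt_of_le_of_lt (norm_le_of_forall_apply_le (half_pos hε).le fun w => ?_) (half_lt_self hε)
  rw [ZeroAtInftyContinuousMap.sub_apply, sum_smul_delta_apply]
  split_ifs with h
  · simpa using (half_pos hε).le
  · rw [zero_sub, norm_neg]
    exact (not_not.1 fun hw => h (hT (hfin.mem_toFinset.2 hw))).le

lemma mulOp_delta (φ : BoundedContinuousFunction Z ℂ) (z : Z) :
    mulOp φ (delta z) = φ z • delta z := by
  ext w
  rw [mulOp_apply, ZeroAtInftyContinuousMap.smul_apply, smul_eq_mul]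
  rcases eq_or_ne w z with rfl | h
  · rfl
  · simp only [delta_apply_of_ne h, mul_zero]

lemma tendsto_sum_smul_delta_mul (φ : BoundedContinuousFunction Z ℂ) (a : C₀(Z, ℂ)) :
    Filter.Tendsto (fun T : Finset Z => (∑ z ∈ T, φ z • delta z) * a) Filter.atTop
      (𝓝 (mulOp φ a)) := by
  classical
  refine (hasSum_delta (mulOp φ a)).congr fun T => ?_
  ext w
  rw [sum_smul_delta_apply, ZeroAtInftyContinuousMap.mul_apply, sum_smul_delta_apply, mulOp_apply,
    ite_zero_mul]

lemma centralizer_fst_apply (m : 𝓜(ℂ, C₀(Z, ℂ))) (a : C₀(Z, ℂ)) (z : Z) :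
    m.fst a z = m.fst (delta z) z * a z := by
  have h (b : C₀(Z, ℂ)) : m.fst b z = m.snd (delta z) z * b z := by
    simpa [delta_apply_self] using (DFunLike.congr_fun (m.central (delta z) b) z).symm
  rw [h a, h (delta z), delta_apply_self, mul_one]

lemma centralizer_snd_apply (m : 𝓜(ℂ, C₀(Z, ℂ))) (a : C₀(Z, ℂ)) (z : Z) :
    m.snd a z = m.fst (delta z) z * a z := by
  have h := DFunLike.congr_fun (m.central a (delta z)) z
  simp only [ZeroAtInftyContinuousMap.mul_apply, delta_apply_self, mul_one] at h
  rw [h, mul_comm]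

lemma exists_mem_center_mulOp_eq_fst (φ : BoundedContinuousFunction Z ℂ) :
    ∃ m ∈ Subalgebra.center ℂ 𝓜(ℂ, C₀(Z, ℂ)), mulOp φ = m.fst := by
  refine ⟨⟨(mulOp φ, mulOp φ), fun a b => ?_⟩, Subalgebra.mem_center_iff.2 fun b => ?_, rfl⟩
  · ext z
    simp only [ZeroAtInftyContinuousMap.mul_apply, mulOp_apply]
    ring
  · refine DoubleCentralizer.ext _ _ _ _ (Prod.ext ?_ ?_)
    · ext a z
      change b.fst (mulOp φ a) z = φ z * b.fst a z
      rw [centralizer_fst_apply b, centralizer_fst_apply b a, mulOp_apply]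
      ring
    · ext a z
      change φ z * b.snd a z = b.snd (mulOp φ a) z
      rw [centralizer_snd_apply b a, centralizer_snd_apply b (mulOp φ a), mulOp_apply]
      ring

end ZeroAtInfty

/-! ### Completely bounded maps -/

section CompletelyBounded

lemma L2.norm_diagOp_le {I K : Type*} [NormedAddCommGroup K] [InnerProductSpace ℂ K]
    {T : I → K →L[ℂ] K} {C : ℝ} (hC : 0 ≤ C) (hT : ∀ i, ‖T i‖ ≤ C) : ‖L2.diagOp T C hT‖ ≤ C :=
  (LinearMap.mkContinuous_norm_le _ (le_max_right _ _) _).trans_eq (max_eq_left hC)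

variable {K V : Type*} [NormedAddCommGroup K] [InnerProductSpace ℂ K] [AddCommGroup V] [Module ℂ V]

lemma inner_blockOp {n : ℕ} (x : Matrix (Fin n) (Fin n) (K →L[ℂ] K)) (η ξ : L2 (Fin n) K) :
    ⟪η, blockOp x ξ⟫_ℂ = ∑ i, ∑ j, ⟪L2.coord i η, x i j (L2.coord j ξ)⟫_ℂ := by
  rw [(L2.hasSum_inner η _).unique (hasSum_fintype _)]
  simp only [blockOp_apply, inner_sum]

lemma continuous_blockOp (n : ℕ) :
    Continuous (blockOp : Matrix (Fin n) (Fin n) (K →L[ℂ] K) → L2 (Fin n) K →L[ℂ] L2 (Fin n) K) :=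
  continuous_finsetSum _ fun i _ => continuous_finsetSum _ fun j _ => by fun_prop

lemma CBBound.mono {j : V →ₗ[ℂ] K →L[ℂ] K} {Φ : V →ₗ[ℂ] V} {C C' : ℝ} (h : CBBound j Φ C)
    (hC : C ≤ C') : CBBound j Φ C' :=
  ⟨h.1.trans hC, fun n x => (h.2 n x).trans (mul_le_mul_of_nonneg_right hC (norm_nonneg _))⟩

lemma CBBound.of_tendsto {ι : Type*} {l : Filter ι} [l.NeBot] {j : V →ₗ[ℂ] K →L[ℂ] K}
    {Φ : ι → V →ₗ[ℂ] V} {Ψ : V →ₗ[ℂ] V} {C : ℝ} (hΦ : ∀ i, CBBound j (Φ i) C)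
    (h : ∀ v, Filter.Tendsto (fun i => j (Φ i v)) l (𝓝 (j (Ψ v)))) : CBBound j Ψ C := by
  obtain ⟨i₀⟩ := l.nonempty_of_neBot
  refine ⟨(hΦ i₀).1, fun n x => ?_⟩
  have hlim : Filter.Tendsto (fun i => x.map fun v => j (Φ i v)) l (𝓝 (x.map fun v => j (Ψ v))) :=
    tendsto_pi_nhds.2 fun a => tendsto_pi_nhds.2 fun b => h (x a b)
  exact le_of_tendsto (((continuous_blockOp n).tendsto _).comp hlim).norm
    (Filter.Eventually.of_forall fun i => (hΦ i).2 n x)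

lemma CBBound.continuous {E : Submodule ℂ (K →L[ℂ] K)} {Φ : E →ₗ[ℂ] E} {C : ℝ}
    (h : CBBound E.subtype Φ C) : Continuous Φ :=
  AddMonoidHomClass.continuous_of_bound Φ C h.norm_le

lemma CStarSystem.cbBound_mulLeft {A G H : Type*} [NonUnitalCStarAlgebra A] [Group G]
    [NormedAddCommGroup H] [InnerProductSpace ℂ H] [CompleteSpace H] (D : CStarSystem A G H)
    (a : A) : CBBound D.repₗ (LinearMap.mulLeft ℂ a) ‖a‖ := by
  refine ⟨norm_nonneg a, fun n x => ?_⟩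
  have hfactor : blockOp (x.map fun v => D.repₗ (LinearMap.mulLeft ℂ a v)) =
      L2.diagOp (fun _ : Fin n => D.rep a) ‖a‖ (fun _ => D.norm_rep_le a) ∘L
        blockOp (x.map fun v => D.repₗ v) := by
    ext ξ i
    rw [ContinuousLinearMap.comp_apply, L2.coord_diagOp, blockOp_apply, blockOp_apply, map_sum]
    refine Finset.sum_congr rfl fun j _ => ?_
    exact DFunLike.congr_fun (map_mul D.rep a (x i j)) _
  rw [hfactor]
  exact (ContinuousLinearMap.opNorm_comp_le _ _).trans
    (mul_le_mul_of_nonneg_right (L2.norm_diagOp_le (norm_nonneg a) _) (norm_nonneg _))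

lemma cbBound_mulOp {Z G H : Type*} [TopologicalSpace Z] [DiscreteTopology Z] [Group G]
    [NormedAddCommGroup H] [InnerProductSpace ℂ H] [CompleteSpace H]
    (D : CStarSystem C₀(Z, ℂ) G H) (φ : BoundedContinuousFunction Z ℂ) :
    CBBound D.repₗ (mulOp φ).toLinearMap ‖φ‖ := by
  classical
  have hrep : Continuous D.repₗ :=
    AddMonoidHomClass.continuous_of_bound D.repₗ 1 fun a =>
      (D.norm_rep_le a).trans_eq (one_mul _).symm
  refine CBBound.of_tendsto (l := Filter.atTop)
    (Φ := fun T : Finset Z => LinearMap.mulLeft ℂ (∑ z ∈ T, φ z • delta z)) (fun T => ?_)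
    fun a => (hrep.tendsto _).comp (tendsto_sum_smul_delta_mul φ a)
  have hT : ‖∑ z ∈ T, φ z • delta z‖ ≤ ‖φ‖ := norm_le_of_forall_apply_le (norm_nonneg φ) fun z => by
    rw [sum_smul_delta_apply]
    split_ifs
    · exact φ.norm_coe_le_norm z
    · exact norm_zero.trans_le (norm_nonneg φ)
  exact (D.cbBound_mulLeft _).mono hT

end CompletelyBounded

/-! ### Generators of the reduced crossed product -/

namespace CStarSystem

variable {A G H : Type*} [NonUnitalCStarAlgebra A] [Group G] [NormedAddCommGroup H]
  [InnerProductSpace ℂ H] [CompleteSpace H] (D : CStarSystem A G H)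

/-- The element `π(a) λ_s` of the reduced crossed product, as a continuous function of `a`. -/
def coeff (s : G) : A →L[ℂ] D.crossedProduct :=
  letI := Classical.decEq G
  LinearMap.mkContinuous
    { toFun := fun a => D.toCrossedProduct ⟨Pi.single s a, single_mem_ell1 s a⟩
      map_add' := fun a b => by
        rw [← map_add]
        exact congrArg _ (Subtype.ext (Pi.single_add (f := fun _ : G => A) s a b))
      map_smul' := fun c a => by
        rw [← map_smul]
        exact congrArg _ (Subtype.ext (Pi.single_smul (f := fun _ : G => A) s c a)) }
    1 fun a => by
      rw [one_mul]
      exact ((congrArg norm (D.integrated_single s a)).trans (D.norm_reprA_mul a s)).le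

lemma coe_coeff (s : G) (a : A) :
    (D.coeff s a : L2 G H →L[ℂ] L2 G H) = D.reprA a * reprG H s :=
  @integrated_single A G H _ _ _ _ _ D (Classical.decEq G) s a

lemma norm_coeff (s : G) (a : A) : ‖D.coeff s a‖ = ‖a‖ :=
  (congrArg norm (D.coe_coeff s a)).trans (D.norm_reprA_mul a s)

lemma hasSum_coeff (f : ell1 G A) :
    HasSum (fun s => D.coeff s ((f : G → A) s)) (D.toCrossedProduct f) := by
  refine (Topology.IsInducing.hasSum_iff (g := D.crossedProduct.subtype) ⟨rfl⟩ _ _).1 ?_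
  exact (D.summable_integrated f.2).hasSum.congr_fun fun s => D.coe_coeff s _

lemma denseRange_toCrossedProduct : DenseRange D.toCrossedProduct := by
  have hd : DenseRange fun t : LinearMap.range D.integratedₗ =>
      (⟨t, Submodule.le_topologicalClosure _ t.2⟩ : D.crossedProduct) :=
    (denseRange_inclusion_iff subset_closure).2 subset_rfl
  refine hd.mono ?_
  rintro _ ⟨⟨_, f, rfl⟩, rfl⟩
  exact ⟨f, rfl⟩

variable {D}

lemma implements_of_map_coeff {F : G → A →L[ℂ] A} {Φ : D.crossedProduct →ₗ[ℂ] D.crossedProduct}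
    {C : ℝ} (hF : ∀ r, CBBound D.repₗ (F r).toLinearMap C) (hΦ : Continuous Φ)
    (h : ∀ s a, Φ (D.coeff s a) = D.coeff s (F s a)) : D.Implements F Φ := by
  intro f
  have hsum : HasSum (fun s => D.coeff s (F s ((f : G → A) s))) (Φ (D.toCrossedProduct f)) := by
    simpa only [Function.comp_def, h] using (D.hasSum_coeff f).map Φ hΦ
  exact congrArg Subtype.val (hsum.unique (D.hasSum_coeff ⟨_, mem_ell1_of_bound hF f.2⟩))

lemma CentralMultiplier.S_coeff (F : D.CentralMultiplier) (s : G) (a : A) :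
    F.S (D.coeff s a) = D.coeff s (F.toFun s a) := by
  classical
  refine Subtype.ext ((F.implements_S _).trans ?_)
  rw [coe_coeff, ← D.integrated_single]
  congr 1
  ext r
  rcases eq_or_ne r s with rfl | h
  · simp
  · simp [h]

end CStarSystem

section Diagonal

variable {Z G H : Type*} [TopologicalSpace Z] [DiscreteTopology Z] [Group G]
  [NormedAddCommGroup H] [InnerProductSpace ℂ H] [CompleteSpace H] {D : CStarSystem C₀(Z, ℂ) G H}

open CStarSystem

lemma mem_of_coeff_delta_mem {S : Submodule ℂ D.crossedProduct}
    (hS : IsClosed (S : Set D.crossedProduct)) (h : ∀ s z, D.coeff s (delta z) ∈ S)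
    (T : D.crossedProduct) : T ∈ S := by
  have hcoeff (s : G) (a : C₀(Z, ℂ)) : D.coeff s a ∈ S := by
    refine hS.mem_of_tendsto ((hasSum_delta a).mapL (D.coeff s))
      (Filter.Eventually.of_forall fun t => S.sum_mem fun z _ => ?_)
    rw [map_smul]
    exact S.smul_mem _ (h s z)
  exact D.denseRange_toCrossedProduct.induction_on T hS fun f => hS.mem_of_tendsto
    (D.hasSum_coeff f) (Filter.Eventually.of_forall fun t => S.sum_mem fun s _ => hcoeff s _)

lemma CStarSystem.CentralMultiplier.toFun_delta (F : D.CentralMultiplier) (s : G) (z : Z) :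
    F.toFun s (delta z) = evalAt D (z, s) F • delta z := by
  obtain ⟨m, -, hm⟩ := F.2.2 s
  have hm' : F.toFun s = m.fst := hm
  ext w
  change F.toFun s (delta z) w = F.toFun s (delta z) z * delta z w
  rw [hm', centralizer_fst_apply m (delta z) w]
  rcases eq_or_ne w z with rfl | h
  · rfl
  · simp only [delta_apply_of_ne h, mul_zero]

lemma CStarSystem.CentralMultiplier.S_coeff_delta (F : D.CentralMultiplier) (s : G) (z : Z) :
    F.S (D.coeff s (delta z)) = evalAt D (z, s) F • D.coeff s (delta z) := by
  rw [F.S_coeff, F.toFun_delta, map_smul]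

variable {Φ : D.crossedProduct →ₗ[ℂ] D.crossedProduct}

lemma map_coeff_eq_coeff_mulOp (hΦ : Continuous Φ) {s : G} {φ : BoundedContinuousFunction Z ℂ}
    (h : ∀ z, Φ (D.coeff s (delta z)) = φ z • D.coeff s (delta z)) (a : C₀(Z, ℂ)) :
    Φ (D.coeff s a) = D.coeff s (mulOp φ a) := by
  have hleft : HasSum (fun z => a z • φ z • D.coeff s (delta z)) (Φ (D.coeff s a)) := by
    simpa only [Function.comp_def, map_smul, h] using
      ((hasSum_delta a).mapL (D.coeff s)).map Φ hΦ
  refine hleft.unique ?_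
  simpa only [ContinuousLinearMap.comp_apply, map_smul, mulOp_delta] using
    (hasSum_delta a).mapL (D.coeff s ∘L mulOp φ)

lemma exists_centralMultiplier_of_diagonal {C : ℝ} (hΦ : CBBound D.crossedProduct.subtype Φ C)
    {φ : Z × G → ℂ} (h : ∀ s z, Φ (D.coeff s (delta z)) = φ (z, s) • D.coeff s (delta z)) :
    ∃ F : D.CentralMultiplier, ∀ p, evalAt D p F = φ p := by
  have hφ (p : Z × G) : ‖φ p‖ ≤ C := by
    have hpos : 0 < ‖D.coeff p.2 (delta p.1)‖ := by
      rw [norm_coeff]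
      exact norm_pos_iff.2 (delta_ne_zero p.1)
    refine le_of_mul_le_mul_right ?_ hpos
    rw [← norm_smul, ← h]
    exact hΦ.norm_le _
  let ψ (s : G) : BoundedContinuousFunction Z ℂ :=
    BoundedContinuousFunction.ofNormedAddCommGroupDiscrete (fun z => φ (z, s)) C fun z => hφ (z, s)
  have hψ (s : G) : CBBound D.repₗ (mulOp (ψ s)).toLinearMap C :=
    (cbBound_mulOp D (ψ s)).mono (BoundedContinuousFunction.norm_ofNormedAddCommGroup_le _ hΦ.1 _)
  have himpl : D.Implements (fun s => mulOp (ψ s)) Φ :=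
    implements_of_map_coeff hψ hΦ.continuous fun s =>
      map_coeff_eq_coeff_mulOp hΦ.continuous (h s)
  refine ⟨⟨fun s => mulOp (ψ s), ⟨⟨C, hψ⟩, Φ, ⟨C, hΦ⟩, himpl⟩, fun s =>
    exists_mem_center_mulOp_eq_fst (ψ s)⟩, fun p => ?_⟩
  change φ p * delta p.1 p.1 = φ p
  rw [delta_apply_self, mul_one]

end Diagonal

/-! ### Functionals on the dual of the multipliers -/

section VectorFunctional

variable {K : Type*} [NormedAddCommGroup K] [InnerProductSpace ℂ K]

/-- The vector functional `T ↦ ⟪η, T ξ⟫`. -/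
def vectorFunctional (η ξ : K) : StrongDual ℂ (K →L[ℂ] K) :=
  innerSL ℂ η ∘L ContinuousLinearMap.apply ℂ K ξ

lemma vectorFunctional_apply (η ξ : K) (T : K →L[ℂ] K) : vectorFunctional η ξ T = ⟪η, T ξ⟫_ℂ := rfl

lemma norm_vectorFunctional_le (η ξ : K) : ‖vectorFunctional η ξ‖ ≤ ‖η‖ * ‖ξ‖ :=
  ContinuousLinearMap.opNorm_le_bound _ (by positivity) fun T =>
    ((norm_inner_le_norm η (T ξ)).trans
      (mul_le_mul_of_nonneg_left (T.le_opNorm ξ) (norm_nonneg η))).trans_eq (by ring)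

lemma norm_le_of_norm_inner_le {T : K →L[ℂ] K} {C : ℝ} (hC : 0 ≤ C)
    (h : ∀ η ξ, ‖η‖ = 1 → ‖ξ‖ = 1 → ‖⟪η, T ξ⟫_ℂ‖ ≤ C) : ‖T‖ ≤ C :=
  ContinuousLinearMap.opNorm_le_of_re_inner_le (𝕜 := ℂ) hC fun ξ η hξ hη =>
    (RCLike.re_le_norm _).trans ((norm_inner_symm _ _).trans_le (h η ξ hη hξ))

variable {X : Type*} [NormedAddCommGroup X] [NormedSpace ℂ X]
  (Λ : StrongDual ℂ (StrongDual ℂ X))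

lemma norm_bidual_vectorFunctional_le (W : X →L[ℂ] K →L[ℂ] K) (η ξ : K) :
    ‖Λ (vectorFunctional η ξ ∘L W)‖ ≤ ‖Λ‖ * ‖W‖ * ‖η‖ * ‖ξ‖ :=
  calc ‖Λ (vectorFunctional η ξ ∘L W)‖ ≤ ‖Λ‖ * ((‖η‖ * ‖ξ‖) * ‖W‖) :=
        Λ.le_opNorm_of_le (((vectorFunctional η ξ).opNorm_comp_le W).trans
          (mul_le_mul_of_nonneg_right (norm_vectorFunctional_le η ξ) (norm_nonneg W)))
    _ = ‖Λ‖ * ‖W‖ * ‖η‖ * ‖ξ‖ := by ring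

variable [CompleteSpace K]

/-- The value at `Λ ∈ X**` of the weak* continuous extension `X** → B(K)` of a bounded linear map
`W : X → B(K)`. -/
def bidualOperator (W : X →L[ℂ] K →L[ℂ] K) : K →L[ℂ] K :=
  ContinuousLinearMap.adjoint (InnerProductSpace.continuousLinearMapOfBilin
    ((LinearMap.mk₂'ₛₗ (starRingEnd ℂ) (RingHom.id ℂ)
      (fun η ξ => Λ (vectorFunctional η ξ ∘L W))
      (fun η η' ξ => by rw [← map_add]; congr 1; ext x; simp [vectorFunctional_apply])
      (fun c η ξ => by rw [← map_smul]; congr 1; ext x; simp [vectorFunctional_apply, mul_comm])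
      (fun η ξ ξ' => by rw [← map_add]; congr 1; ext x; simp [vectorFunctional_apply])
      (fun c η ξ => by rw [← map_smulₛₗ]; congr 1; ext x; simp [vectorFunctional_apply])
      ).mkContinuous₂ (‖Λ‖ * ‖W‖) (norm_bidual_vectorFunctional_le Λ W)))

lemma inner_bidualOperator (W : X →L[ℂ] K →L[ℂ] K) (η ξ : K) :
    ⟪η, bidualOperator Λ W ξ⟫_ℂ = Λ (vectorFunctional η ξ ∘L W) := by
  rw [bidualOperator, ContinuousLinearMap.adjoint_inner_right,
    InnerProductSpace.continuousLinearMapOfBilin_apply]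
  rfl

/-- `bidualOperator` as a bounded linear function of the map that is extended. -/
def bidualExtend : (X →L[ℂ] K →L[ℂ] K) →L[ℂ] K →L[ℂ] K :=
  LinearMap.mkContinuous
    { toFun := bidualOperator Λ
      map_add' := fun V W => by
        refine ContinuousLinearMap.ext fun ξ => ext_inner_left ℂ fun η => ?_
        simp only [add_apply, inner_add_right, inner_bidualOperator, ContinuousLinearMap.comp_add,
          map_add]
      map_smul' := fun c W => by
        refine ContinuousLinearMap.ext fun ξ => ext_inner_left ℂ fun η => ?_
        simp only [smul_apply, inner_smul_right, inner_bidualOperator,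
          ContinuousLinearMap.comp_smul, map_smul, smul_eq_mul, RingHom.id_apply] }
    ‖Λ‖ fun W => norm_le_of_norm_inner_le (by positivity) fun η ξ hη hξ => by
      simpa [hη, hξ, inner_bidualOperator] using norm_bidual_vectorFunctional_le Λ W η ξ

lemma inner_bidualExtend (W : X →L[ℂ] K →L[ℂ] K) (η ξ : K) :
    ⟪η, bidualExtend Λ W ξ⟫_ℂ = Λ (vectorFunctional η ξ ∘L W) :=
  inner_bidualOperator Λ W η ξ

lemma bidualExtend_smulRight (f : StrongDual ℂ X) (T : K →L[ℂ] K) :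
    bidualExtend Λ (f.smulRight T) = Λ f • T := by
  refine ContinuousLinearMap.ext fun ξ => ext_inner_left ℂ fun η => ?_
  have h : vectorFunctional η ξ ∘L f.smulRight T = ⟪η, T ξ⟫_ℂ • f := by
    ext x
    simp [vectorFunctional_apply, mul_comm]
  rw [inner_bidualExtend, h, map_smul, smul_apply, inner_smul_right, smul_eq_mul, mul_comm]

lemma norm_blockOp_bidualExtend_le {n : ℕ} (W : Matrix (Fin n) (Fin n) (X →L[ℂ] K →L[ℂ] K))
    {C : ℝ} (hC : 0 ≤ C) (h : ∀ x, ‖blockOp (W.map fun w => w x)‖ ≤ C * ‖x‖) :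
    ‖blockOp (W.map (bidualExtend Λ))‖ ≤ ‖Λ‖ * C := by
  refine norm_le_of_norm_inner_le (by positivity) fun η ξ hη hξ => ?_
  let f : StrongDual ℂ X :=
    ∑ i, ∑ j, vectorFunctional (L2.coord i η) (L2.coord j ξ) ∘L W i j
  have hf : ∀ x, f x = vectorFunctional η ξ (blockOp (W.map fun w => w x)) := fun x => by
    rw [vectorFunctional_apply, inner_blockOp]
    simp only [f, sum_apply]
    rfl
  have hnorm : ‖f‖ ≤ C := ContinuousLinearMap.opNorm_le_bound f hC fun x => by
    rw [hf]
    refine (ContinuousLinearMap.le_of_opNorm_le _ (norm_vectorFunctional_le η ξ) _).trans ?_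
    simpa [hη, hξ] using h x
  have hΛ : ⟪η, blockOp (W.map (bidualExtend Λ)) ξ⟫_ℂ = Λ f := by
    simp only [inner_blockOp, Matrix.map_apply, inner_bidualExtend, f, map_sum]
  rw [hΛ]
  exact Λ.le_opNorm_of_le hnorm

end VectorFunctional

section Bidual

variable {A G H : Type*} [NonUnitalCStarAlgebra A] [Group G] [NormedAddCommGroup H]
  [InnerProductSpace ℂ H] [CompleteSpace H] (D : CStarSystem A G H)

/-- The bounded bilinear map `(T, F) ↦ S_F(T)`. -/
def multiplierAction : D.crossedProduct →L[ℂ] D.CentralMultiplier →L[ℂ] L2 G H →L[ℂ] L2 G H :=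
  LinearMap.mkContinuous₂
    (LinearMap.mk₂ ℂ (fun T F => (F.S T : L2 G H →L[ℂ] L2 G H))
      (fun T T' F => by rw [map_add]; rfl)
      (fun c T F => by rw [map_smul]; rfl)
      (fun T F F' => by rw [F.S_add]; rfl)
      (fun c T F => by rw [F.S_smul]; rfl))
    1 fun T F => (F.norm_S_le T).trans_eq (by rw [one_mul, mul_comm])

lemma multiplierAction_apply (T : D.crossedProduct) (F : D.CentralMultiplier) :
    multiplierAction D T F = F.S T := rfl

variable {Z : Type*} [TopologicalSpace Z] [DiscreteTopology Z] (D : CStarSystem C₀(Z, ℂ) G H)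

lemma multiplierAction_coeff_delta (s : G) (z : Z) :
    multiplierAction D (D.coeff s (delta z)) =
      (evalAt D (z, s)).smulRight (D.coeff s (delta z) : L2 G H →L[ℂ] L2 G H) := by
  refine ContinuousLinearMap.ext fun F => ?_
  rw [multiplierAction_apply, F.S_coeff_delta]
  rfl

lemma exists_multiplier_of_bidual (Λ : StrongDual ℂ (StrongDual ℂ D.CentralMultiplier)) :
    ∃ F : D.CentralMultiplier, ∀ p, evalAt D p F = Λ (evalAt D p) := by
  let Φ : D.crossedProduct →L[ℂ] L2 G H →L[ℂ] L2 G H := bidualExtend Λ ∘L multiplierAction D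
  have hdiag : ∀ s z, Φ (D.coeff s (delta z)) =
      Λ (evalAt D (z, s)) • (D.coeff s (delta z) : L2 G H →L[ℂ] L2 G H) := fun s z => by
    rw [ContinuousLinearMap.comp_apply, multiplierAction_coeff_delta, bidualExtend_smulRight]
  have hmem : ∀ T, Φ T ∈ D.crossedProduct :=
    mem_of_coeff_delta_mem (S := D.crossedProduct.comap Φ.toLinearMap)
      ((Submodule.isClosed_topologicalClosure _).preimage Φ.continuous) fun s z => by
        rw [Submodule.mem_comap, ContinuousLinearMap.coe_coe, hdiag]
        exact D.crossedProduct.smul_mem _ (Subtype.coe_prop _)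
  have hcb : CBBound D.crossedProduct.subtype
      (Φ.toLinearMap.codRestrict D.crossedProduct hmem) ‖Λ‖ :=
    ⟨norm_nonneg Λ, fun n x => norm_blockOp_bidualExtend_le Λ (x.map (multiplierAction D))
      (norm_nonneg _) fun F => (F.isCB_S.bound.2 n x).trans_eq (mul_comm _ _)⟩
  exact exists_centralMultiplier_of_diagonal (φ := fun p => Λ (evalAt D p)) hcb
    fun s z => Subtype.ext (hdiag s z)

lemma exists_multiplier_eq_on_Qcent (Λ : StrongDual ℂ (StrongDual ℂ D.CentralMultiplier)) :
    ∃ F : D.CentralMultiplier,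
      ∀ q ∈ (LinearMap.range (pairing D)).topologicalClosure, Λ q = q F := by
  obtain ⟨F, hF⟩ := exists_multiplier_of_bidual D Λ
  have hle : (LinearMap.range (pairing D)).topologicalClosure ≤ LinearMap.eqLocus Λ.toLinearMap
      (ContinuousLinearMap.apply ℂ ℂ F).toLinearMap := by
    refine Submodule.topologicalClosure_minimal _ ?_
      (isClosed_eq Λ.continuous (ContinuousLinearMap.apply ℂ ℂ F).continuous)
    rw [pairing, Finsupp.range_linearCombination, Submodule.span_le]
    rintro _ ⟨p, rfl⟩
    exact (hF p).symm
  exact ⟨F, fun q hq => hle hq⟩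

end Bidual

/-! ### The minimal tensor product with the compact operators -/

section TensorOperators

variable {K : Type*} [NormedAddCommGroup K] [InnerProductSpace ℂ K]

lemma norm_tensorOp_le (T : K →L[ℂ] K) (b : SeqL2 →L[ℂ] SeqL2) :
    ‖tensorOp T b‖ ≤ ‖T‖ * ‖b‖ := by
  refine ContinuousLinearMap.opNorm_le_bound _ (by positivity) fun v => ?_
  refine denseRange_toTensorL2.induction_on v (isClosed_le (by fun_prop) (by fun_prop)) fun t => ?_
  have happly : tensorOp T b (toTensorL2 t) = toTensorL2 (TensorProduct.mapL T b t) :=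
    (TensorProduct.mapL T b).completion_apply_coe t
  have hnorm (u : K ⊗[ℂ] SeqL2) : ‖toTensorL2 u‖ = ‖u‖ := UniformSpace.Completion.norm_coe u
  rw [happly, hnorm, hnorm]
  exact ContinuousLinearMap.le_of_opNorm_le _ (TensorProduct.norm_mapL_le T b) t

lemma tensorOp_comp (S T : K →L[ℂ] K) (b c : SeqL2 →L[ℂ] SeqL2) :
    tensorOp S b ∘L tensorOp T c = tensorOp (S ∘L T) (b ∘L c) :=
  tensorOp_ext fun x y => by simp

lemma tensorOp_one_one : tensorOp (1 : K →L[ℂ] K) 1 = 1 :=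
  tensorOp_ext fun x y => by simp

lemma adjoint_tensorOp [CompleteSpace K] (T : K →L[ℂ] K) (b : SeqL2 →L[ℂ] SeqL2) :
    (tensorOp T b).adjoint = tensorOp T.adjoint b.adjoint := by
  refine tensorOp_ext fun x y => ext_inner_right ℂ fun w => ?_
  refine mem_of_tmulL2_mem (LinearMap.eqLocus
    (innerSL ℂ ((tensorOp T b).adjoint (tmulL2 x y))).toLinearMap
    (innerSL ℂ (tensorOp T.adjoint b.adjoint (tmulL2 x y))).toLinearMap)
    (isClosed_eq (ContinuousLinearMap.continuous _) (ContinuousLinearMap.continuous _))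
    (fun x' y' => ?_) w
  simp [ContinuousLinearMap.adjoint_inner_left, inner_tmulL2]

variable {E : Submodule ℂ (K →L[ℂ] K)}

/-- The elementary tensor `T ⊗ b` in `E ⊗ K(ℓ²)`, as a bounded linear map of `T`. -/
def tmulMin (E : Submodule ℂ (K →L[ℂ] K)) (b : CompactL2) : E →L[ℂ] MinTensor E :=
  LinearMap.mkContinuous
    (toMinTensor E ∘ₗ (TensorProduct.mk ℂ E CompactL2).flip b : E →ₗ[ℂ] MinTensor E)
    ‖(b : SeqL2 →L[ℂ] SeqL2)‖ fun T =>
      (norm_tensorOp_le (T : K →L[ℂ] K) (b : SeqL2 →L[ℂ] SeqL2)).trans_eq (mul_comm _ _)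

lemma val_tmulMin (b : CompactL2) (T : E) :
    (tmulMin E b T).val = tensorOp (T : K →L[ℂ] K) (b : SeqL2 →L[ℂ] SeqL2) := rfl

lemma mem_of_tmulMin_mem {S : Submodule ℂ (MinTensor E)} (hS : IsClosed (S : Set (MinTensor E)))
    (h : ∀ b T, tmulMin E b T ∈ S) (a : MinTensor E) : a ∈ S := by
  refine (denseRange_toMinTensor E).induction_on a hS fun t => ?_
  induction t using AlgTensor.induction with
  | zero => rw [map_zero]; exact zero_mem _
  | tmul T b => exact h b T
  | add t t' ht ht' => rw [map_add]; exact add_mem ht ht'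

lemma amplify_tmulMin {Φ : E →ₗ[ℂ] E} (hΦ : IsCB E.subtype Φ) (b : CompactL2) (T : E) :
    amplify Φ (tmulMin E b T) = tmulMin E b (Φ T) :=
  hΦ.bound.amplify_apply _

/-- The compact operator `c b d`, for `b` compact. -/
def compactBiMul (c d : SeqL2 →L[ℂ] SeqL2) (b : CompactL2) : CompactL2 :=
  ⟨c ∘L (b : SeqL2 →L[ℂ] SeqL2) ∘L d, (b.2.comp_clm d).clm_comp c⟩

lemma tensorOp_one_comp_val_mem (c d : SeqL2 →L[ℂ] SeqL2) (a : MinTensor E) :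
    tensorOp 1 c ∘L a.val ∘L tensorOp 1 d ∈
      (LinearMap.range (algTensor E)).topologicalClosure := by
  let L : MinTensor E →L[ℂ] TensorL2 K →L[ℂ] TensorL2 K :=
    ContinuousLinearMap.compL ℂ _ _ _ (tensorOp 1 c) ∘L
      (ContinuousLinearMap.compL ℂ _ _ _).flip (tensorOp 1 d) ∘L MinTensor.val
  refine mem_of_tmulMin_mem
    (S := (LinearMap.range (algTensor E)).topologicalClosure.comap L.toLinearMap)
    ((Submodule.isClosed_topologicalClosure _).preimage L.continuous) (fun b T => ?_) a
  have h : L (tmulMin E b T) = algTensor E (AlgTensor.tmul T (compactBiMul c d b)) :=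
    tensorOp_ext fun x y => by simp [L, val_tmulMin, compactBiMul]
  rw [Submodule.mem_comap, ContinuousLinearMap.coe_coe, h]
  exact Submodule.le_topologicalClosure _ (LinearMap.mem_range_self _ _)

/-- The map `a ↦ (1 ⊗ c) a (1 ⊗ d)` on `E ⊗ K(ℓ²)`. -/
def MinTensor.biMul (E : Submodule ℂ (K →L[ℂ] K)) (c d : SeqL2 →L[ℂ] SeqL2) :
    MinTensor E →L[ℂ] MinTensor E :=
  LinearMap.mkContinuous
    (LinearMap.codRestrict (LinearMap.range (algTensor E)).topologicalClosure
      { toFun := fun a => tensorOp 1 c ∘L MinTensor.val a ∘L tensorOp 1 d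
        map_add' := fun a b => by ext v; simp
        map_smul' := fun z a => by ext v; simp } (tensorOp_one_comp_val_mem c d))
    (‖tensorOp (1 : K →L[ℂ] K) c‖ * ‖tensorOp (1 : K →L[ℂ] K) d‖) fun a =>
      calc ‖tensorOp 1 c ∘L MinTensor.val a ∘L tensorOp 1 d‖
          ≤ ‖tensorOp (1 : K →L[ℂ] K) c‖ * (‖MinTensor.val a‖ * ‖tensorOp (1 : K →L[ℂ] K) d‖) :=
            (ContinuousLinearMap.opNorm_comp_le _ _).trans
              (mul_le_mul_of_nonneg_left (ContinuousLinearMap.opNorm_comp_le _ _) (norm_nonneg _))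
        _ = _ := by rw [MinTensor.norm_val]; ring

lemma MinTensor.val_biMul (c d : SeqL2 →L[ℂ] SeqL2) (a : MinTensor E) :
    (biMul E c d a).val = tensorOp 1 c ∘L a.val ∘L tensorOp 1 d := rfl

lemma MinTensor.biMul_tmulMin (c d : SeqL2 →L[ℂ] SeqL2) (b : CompactL2) (T : E) :
    biMul E c d (tmulMin E b T) = tmulMin E (compactBiMul c d b) T :=
  Subtype.ext (tensorOp_ext fun x y => by
    change (biMul E c d (tmulMin E b T)).val _ = (tmulMin E (compactBiMul c d b) T).val _
    simp [val_biMul, val_tmulMin, compactBiMul])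

lemma amplify_biMul {Φ : E →ₗ[ℂ] E} (hΦ : IsCB E.subtype Φ) (c d : SeqL2 →L[ℂ] SeqL2)
    (a : MinTensor E) :
    amplify Φ (MinTensor.biMul E c d a) = MinTensor.biMul E c d (amplify Φ a) :=
  mem_of_tmulMin_mem (S := LinearMap.eqLocus (amplify Φ ∘L MinTensor.biMul E c d).toLinearMap
    (MinTensor.biMul E c d ∘L amplify Φ).toLinearMap)
    (isClosed_eq (ContinuousLinearMap.continuous _) (ContinuousLinearMap.continuous _))
    (fun b T => by
      simp only [LinearMap.mem_eqLocus, ContinuousLinearMap.coe_coe,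
        ContinuousLinearMap.comp_apply, MinTensor.biMul_tmulMin, amplify_tmulMin hΦ]) a

end TensorOperators

section MatrixUnits

variable {K : Type*} [NormedAddCommGroup K] [InnerProductSpace ℂ K]

/-- The rank one operator `y ↦ y_j e_i` on `ℓ²`. -/
def matrixUnit (i j : ℕ) : CompactL2 :=
  ⟨(ContinuousLinearMap.toSpanSingleton ℂ (basisL2 i)) ∘L L2.coord j,
    (isCompactOperator_of_locallyCompactSpace_rng
      (ContinuousLinearMap.toSpanSingleton ℂ (basisL2 i))).comp_clm _⟩

lemma matrixUnit_apply (i j : ℕ) (y : SeqL2) :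
    (matrixUnit i j : SeqL2 →L[ℂ] SeqL2) y = L2.coord j y • basisL2 i := rfl

lemma L2.inner_single {I : Type*} (i : I) (k : K) (ξ : L2 I K) :
    ⟪L2.single i k, ξ⟫_ℂ = ⟪k, L2.coord i ξ⟫_ℂ := by
  classical
  rw [← (L2.hasSum_inner _ ξ).tsum_eq,
    tsum_eq_single i fun j hj => by rw [L2.coord_single, if_neg hj, inner_zero_left],
    L2.coord_single, if_pos rfl]

/-- `inclFin` as a linear isometry `Kⁿ → K ⊗ ℓ²`. -/
def inclFinₗᵢ (n : ℕ) : L2 (Fin n) K →ₗᵢ[ℂ] TensorL2 K where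
  toFun := inclFin n
  map_add' ξ η := by simp [inclFin, tmulL2_add, Finset.sum_add_distrib]
  map_smul' c ξ := by simp [inclFin, tmulL2_smul, Finset.smul_sum]
  norm_map' := norm_inclFin

lemma inclFinₗᵢ_apply {n : ℕ} (ξ : L2 (Fin n) K) :
    (inclFinₗᵢ n).toContinuousLinearMap ξ = ∑ i : Fin n, tmulL2 (L2.coord i ξ) (basisL2 i) := rfl

/-- The element `∑ x_{ij} ⊗ e_{ij}` of `E ⊙ K(ℓ²)`. -/
def ofMatrix {E : Submodule ℂ (K →L[ℂ] K)} {n : ℕ} (x : Matrix (Fin n) (Fin n) E) : AlgTensor E :=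
  ∑ i, ∑ j, AlgTensor.tmul (x i j) (matrixUnit i j)

lemma AlgTensor.map_ofMatrix {E : Submodule ℂ (K →L[ℂ] K)} (Φ : E →ₗ[ℂ] E) {n : ℕ}
    (x : Matrix (Fin n) (Fin n) E) : map Φ (ofMatrix x) = ofMatrix (x.map Φ) := by
  simp only [ofMatrix, map_sum, map_tmul, Matrix.map_apply]

variable [CompleteSpace K]

lemma coord_adjoint_inclFinₗᵢ {n : ℕ} (x : K) (y : SeqL2) (i : Fin n) :
    L2.coord i ((inclFinₗᵢ n).toContinuousLinearMap.adjoint (tmulL2 x y)) =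
      L2.coord (i : ℕ) y • x := by
  refine ext_inner_left ℂ fun k => ?_
  rw [← L2.inner_single, ContinuousLinearMap.adjoint_inner_right, inclFinₗᵢ_apply,
    Finset.sum_eq_single i (fun j _ hj => by simp [L2.coord_single, hj, tmulL2_apply]) (by simp),
    L2.coord_single, if_pos rfl, inner_tmulL2, inner_basisL2, inner_smul_right, mul_comm]

variable {E : Submodule ℂ (K →L[ℂ] K)}

lemma algTensor_ofMatrix {n : ℕ} (x : Matrix (Fin n) (Fin n) E) :
    algTensor E (ofMatrix x) = (inclFinₗᵢ n).toContinuousLinearMap ∘L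
      blockOp (x.map fun v => E.subtype v) ∘L
        (inclFinₗᵢ n).toContinuousLinearMap.adjoint := by
  refine tensorOp_ext fun u y => ?_
  simp only [ofMatrix, map_sum, algTensor_tmul, sum_apply, tensorOp_tmulL2,
    ContinuousLinearMap.comp_apply, inclFinₗᵢ_apply, blockOp_apply, coord_adjoint_inclFinₗᵢ,
    matrixUnit_apply, map_smul]
  refine Finset.sum_congr rfl fun i _ => ?_
  simp only [tmulL2_apply, TensorProduct.sum_tmul, map_sum, Matrix.map_apply,
    Submodule.subtype_apply, ← TensorProduct.smul_tmul', map_smul]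

lemma norm_algTensor_ofMatrix {n : ℕ} (x : Matrix (Fin n) (Fin n) E) :
    ‖algTensor E (ofMatrix x)‖ = ‖blockOp (x.map fun v => E.subtype v)‖ := by
  rw [algTensor_ofMatrix, LinearIsometry.norm_toContinuousLinearMap_comp,
    ← LinearIsometryEquiv.norm_map ContinuousLinearMap.adjoint, ContinuousLinearMap.adjoint_comp,
    ContinuousLinearMap.adjoint_adjoint, LinearIsometry.norm_toContinuousLinearMap_comp,
    LinearIsometryEquiv.norm_map]

lemma cbNorm_eq_norm_amplify {Φ : E →ₗ[ℂ] E} (hΦ : IsCB E.subtype Φ) :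
    cbNorm E.subtype Φ = ‖amplify Φ‖ := by
  refine le_antisymm (CBBound.cbNorm_le ⟨norm_nonneg _, fun n x => ?_⟩)
    ((amplify Φ).opNorm_le_bound cbNorm_nonneg hΦ.bound.norm_amplify_le)
  calc ‖blockOp (x.map fun v => E.subtype (Φ v))‖
      = ‖amplify Φ (toMinTensor E (ofMatrix x))‖ := by
        rw [hΦ.bound.amplify_apply, AlgTensor.map_ofMatrix, norm_toMinTensor,
          norm_algTensor_ofMatrix, Matrix.map_map]
        rfl
    _ ≤ ‖amplify Φ‖ * ‖toMinTensor E (ofMatrix x)‖ := (amplify Φ).le_opNorm _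
    _ = ‖amplify Φ‖ * ‖blockOp (x.map fun v => E.subtype v)‖ := by
        rw [norm_toMinTensor, norm_algTensor_ofMatrix]

end MatrixUnits

/-! ### Orthogonal blocks -/

section BlockOperators

lemma L2.norm_le_of_coord_eq {I J K : Type*} [NormedAddCommGroup K] [InnerProductSpace ℂ K]
    {e : I → J} (he : Function.Injective e) {ξ : L2 I K} {η : L2 J K}
    (h : ∀ i, L2.coord i ξ = L2.coord (e i) η) : ‖ξ‖ ≤ ‖η‖ :=
  le_of_sq_le_sq (hasSum_le_inj e he (fun _ _ => by positivity) (fun i => by rw [h])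
    ξ.hasSum_norm_sq η.hasSum_norm_sq) (norm_nonneg _)

/-- The operator `(R ξ)(i) = ξ (e i)`, for an injective map `e` of the index sets. -/
def L2.compOp {I J K : Type*} [NormedAddCommGroup K] [InnerProductSpace ℂ K] (e : I → J)
    (he : Function.Injective e) : L2 J K →L[ℂ] L2 I K :=
  LinearMap.mkContinuous
    { toFun := fun ξ => L2.mk (fun i => L2.coord (e i) ξ) <|
        L2.memlp_iff.2 (ξ.hasSum_norm_sq.summable.comp_injective he)
      map_add' := fun ξ η => by ext i; simp
      map_smul' := fun c ξ => by ext i; simp }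
    1 fun ξ => (L2.norm_le_of_coord_eq he fun _ => rfl).trans_eq (one_mul _).symm

/-- The coisometry of `ℓ²` with `(R_k y)(i) = y(⟨k, i⟩)`, for the pairing `⟨·, ·⟩ : ℕ × ℕ → ℕ`. -/
def blockProj (k : ℕ) : SeqL2 →L[ℂ] SeqL2 :=
  L2.compOp (Nat.pair k) fun _ _ h => (Nat.pair_eq_pair.1 h).2

lemma coord_blockProj (k i : ℕ) (y : SeqL2) :
    L2.coord i (blockProj k y) = L2.coord (Nat.pair k i) y := rfl

/-- The isometry `R_k^*` of `ℓ²`. -/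
def blockIncl (k : ℕ) : SeqL2 →L[ℂ] SeqL2 := (blockProj k).adjoint

lemma blockProj_basisL2 (k l i : ℕ) :
    blockProj k (basisL2 (Nat.pair l i)) = if k = l then basisL2 i else 0 := by
  ext j
  rw [coord_blockProj, basisL2, L2.coord_single]
  rcases eq_or_ne k l with rfl | h
  · simp [basisL2, L2.coord_single, Nat.pair_eq_pair]
  · simp [h, Nat.pair_eq_pair]

lemma blockProj_comp_blockIncl (k l : ℕ) :
    blockProj k ∘L blockIncl l = if k = l then 1 else 0 := by
  ext y i
  rw [ContinuousLinearMap.comp_apply, coord_blockProj, ← inner_basisL2, blockIncl,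
    ContinuousLinearMap.adjoint_inner_right, blockProj_basisL2]
  rcases eq_or_ne k l with rfl | h
  · simp [inner_basisL2]
  · simp [h, h.symm]

end BlockOperators

section BlockTensors

variable {K : Type*} [NormedAddCommGroup K] [InnerProductSpace ℂ K]

variable (K) in
/-- The isometry `1 ⊗ R_k^*` of `K ⊗ ℓ²`, onto the `k`-th of countably many orthogonal blocks. -/
def inclTensor (k : ℕ) : TensorL2 K →L[ℂ] TensorL2 K := tensorOp 1 (blockIncl k)

variable (K) in
/-- The coisometry `1 ⊗ R_k` of `K ⊗ ℓ²`, the adjoint of `inclTensor K k`. -/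
def projTensor (k : ℕ) : TensorL2 K →L[ℂ] TensorL2 K := tensorOp 1 (blockProj k)

lemma projTensor_comp_inclTensor (k l : ℕ) :
    projTensor K k ∘L inclTensor K l = if k = l then 1 else 0 := by
  rw [projTensor, inclTensor, tensorOp_comp, blockProj_comp_blockIncl]
  split_ifs
  · exact tensorOp_one_one
  · exact tensorOp_ext fun x y => by simp

lemma projTensor_inclTensor_self (k : ℕ) (u : TensorL2 K) :
    projTensor K k (inclTensor K k u) = u := by
  simpa using DFunLike.congr_fun (projTensor_comp_inclTensor (K := K) k k) u

lemma projTensor_inclTensor_of_ne {k l : ℕ} (h : k ≠ l) (u : TensorL2 K) :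
    projTensor K k (inclTensor K l u) = 0 := by
  simpa [h] using DFunLike.congr_fun (projTensor_comp_inclTensor (K := K) k l) u

variable {E : Submodule ℂ (K →L[ℂ] K)}

/-- The placement `a ↦ (1 ⊗ R_k^*) a (1 ⊗ R_k)` of an operator in the `k`-th diagonal block. -/
def blockMin (E : Submodule ℂ (K →L[ℂ] K)) (k : ℕ) : MinTensor E →L[ℂ] MinTensor E :=
  MinTensor.biMul E (blockIncl k) (blockProj k)

lemma val_blockMin_apply (k : ℕ) (a : MinTensor E) (v : TensorL2 K) :
    (blockMin E k a).val v = inclTensor K k (a.val (projTensor K k v)) := rfl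

lemma amplify_blockMin {Φ : E →ₗ[ℂ] E} (hΦ : IsCB E.subtype Φ) (k : ℕ) (a : MinTensor E) :
    amplify Φ (blockMin E k a) = blockMin E k (amplify Φ a) :=
  amplify_biMul hΦ _ _ a

variable [CompleteSpace K]

lemma adjoint_projTensor (k : ℕ) : (projTensor K k).adjoint = inclTensor K k := by
  rw [projTensor, adjoint_tensorOp, inclTensor, blockIncl]
  congr 1
  exact ContinuousLinearMap.adjoint_id

lemma inner_inclTensor_left (k : ℕ) (u v : TensorL2 K) :
    ⟪inclTensor K k u, v⟫_ℂ = ⟪u, projTensor K k v⟫_ℂ := by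
  rw [← adjoint_projTensor, ContinuousLinearMap.adjoint_inner_left]

lemma inner_inclTensor_right (k : ℕ) (u v : TensorL2 K) :
    ⟪u, inclTensor K k v⟫_ℂ = ⟪projTensor K k u, v⟫_ℂ := by
  rw [← adjoint_projTensor, ContinuousLinearMap.adjoint_inner_right]

lemma norm_inclTensor (k : ℕ) (u : TensorL2 K) : ‖inclTensor K k u‖ = ‖u‖ := by
  rw [@norm_eq_sqrt_re_inner ℂ, @norm_eq_sqrt_re_inner ℂ _ _ _ _ u, inner_inclTensor_left,
    projTensor_inclTensor_self]

lemma norm_inclTensor_add_sq {k l : ℕ} (h : k ≠ l) (u v : TensorL2 K) :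
    ‖inclTensor K k u + inclTensor K l v‖ ^ 2 = ‖u‖ ^ 2 + ‖v‖ ^ 2 := by
  rw [@norm_add_sq ℂ, inner_inclTensor_left, projTensor_inclTensor_of_ne h, norm_inclTensor,
    norm_inclTensor, inner_zero_right, map_zero, mul_zero, add_zero]

lemma norm_projTensor_sq_add_le {k l : ℕ} (h : k ≠ l) (v : TensorL2 K) :
    ‖projTensor K k v‖ ^ 2 + ‖projTensor K l v‖ ^ 2 ≤ ‖v‖ ^ 2 := by
  set p := inclTensor K k (projTensor K k v) + inclTensor K l (projTensor K l v) with hp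
  have hp_sq : ‖p‖ ^ 2 = ‖projTensor K k v‖ ^ 2 + ‖projTensor K l v‖ ^ 2 :=
    norm_inclTensor_add_sq h _ _
  have hp_inner : ‖p‖ ^ 2 = RCLike.re ⟪p, v⟫_ℂ := by
    rw [hp_sq, hp, inner_add_left, inner_inclTensor_left, inner_inclTensor_left, map_add,
      inner_self_eq_norm_sq, inner_self_eq_norm_sq]
  have hp_le : ‖p‖ ^ 2 ≤ ‖p‖ * ‖v‖ := hp_inner.trans_le (re_inner_le_norm p v)
  rw [← hp_sq]
  nlinarith [sq_nonneg (‖p‖ - ‖v‖)]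

lemma norm_projTensor_le (k : ℕ) (v : TensorL2 K) : ‖projTensor K k v‖ ≤ ‖v‖ :=
  le_of_sq_le_sq (by nlinarith [norm_projTensor_sq_add_le k.succ_ne_self.symm v]) (norm_nonneg v)

lemma inner_val_blockMin (k : ℕ) (a : MinTensor E) (u v : TensorL2 K) :
    ⟪u, (blockMin E k a).val v⟫_ℂ = ⟪projTensor K k u, a.val (projTensor K k v)⟫_ℂ := by
  rw [val_blockMin_apply, inner_inclTensor_right]

lemma norm_blockMin_le (k : ℕ) (a : MinTensor E) : ‖blockMin E k a‖ ≤ ‖a‖ := by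
  refine ContinuousLinearMap.opNorm_le_bound _ (norm_nonneg _) fun v => ?_
  calc ‖(blockMin E k a).val v‖ = ‖a.val (projTensor K k v)‖ := by
        rw [val_blockMin_apply, norm_inclTensor]
    _ ≤ ‖a.val‖ * ‖projTensor K k v‖ := a.val.le_opNorm _
    _ ≤ ‖a.val‖ * ‖v‖ := by gcongr; exact norm_projTensor_le k v

lemma norm_blockMin_add_le {k l : ℕ} (h : k ≠ l) {a b : MinTensor E} {C : ℝ} (hC : 0 ≤ C)
    (ha : ‖a‖ ≤ C) (hb : ‖b‖ ≤ C) : ‖blockMin E k a + blockMin E l b‖ ≤ C := by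
  refine ContinuousLinearMap.opNorm_le_bound _ hC fun v => le_of_sq_le_sq ?_ (by positivity)
  have ha' : ‖a.val (projTensor K k v)‖ ≤ C * ‖projTensor K k v‖ := a.val.le_of_opNorm_le ha _
  have hb' : ‖b.val (projTensor K l v)‖ ≤ C * ‖projTensor K l v‖ := b.val.le_of_opNorm_le hb _
  calc ‖inclTensor K k (a.val (projTensor K k v)) + inclTensor K l (b.val (projTensor K l v))‖ ^ 2
      = ‖a.val (projTensor K k v)‖ ^ 2 + ‖b.val (projTensor K l v)‖ ^ 2 :=
        norm_inclTensor_add_sq h _ _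
    _ ≤ (C * ‖projTensor K k v‖) ^ 2 + (C * ‖projTensor K l v‖) ^ 2 := by gcongr
    _ = C ^ 2 * (‖projTensor K k v‖ ^ 2 + ‖projTensor K l v‖ ^ 2) := by ring
    _ ≤ C ^ 2 * ‖v‖ ^ 2 := by gcongr; exact norm_projTensor_sq_add_le h v
    _ = (C * ‖v‖) ^ 2 := by ring

lemma norm_inclTensor_sqrt_smul_add_le {k l : ℕ} (hkl : k ≠ l) {ζ ζ' : TensorL2 K} (hζ : ‖ζ‖ ≤ 1)
    (hζ' : ‖ζ'‖ ≤ 1) {s t : ℝ} (hs : 0 ≤ s) (ht : 0 ≤ t) (hst : s + t = 1) :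
    ‖inclTensor K k ((√s : ℂ) • ζ) + inclTensor K l ((√t : ℂ) • ζ')‖ ≤ 1 := by
  refine le_of_sq_le_sq ?_ zero_le_one
  rw [norm_inclTensor_add_sq hkl, norm_smul, norm_smul, mul_pow, mul_pow,
    Complex.norm_real, Complex.norm_real, Real.norm_eq_abs, Real.norm_eq_abs, sq_abs, sq_abs,
    Real.sq_sqrt hs, Real.sq_sqrt ht]
  have hζ_sq : ‖ζ‖ ^ 2 ≤ 1 := pow_le_one₀ (norm_nonneg _) hζ
  have hζ'_sq : ‖ζ'‖ ^ 2 ≤ 1 := pow_le_one₀ (norm_nonneg _) hζ'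
  nlinarith

lemma exists_forall_projTensor_eq {ζ : ℕ → TensorL2 K} (h : Summable fun k => ‖ζ k‖) :
    ∃ ζ', ∀ k, projTensor K k ζ' = ζ k := by
  have hs : Summable fun k => inclTensor K k (ζ k) :=
    h.of_norm_bounded fun k => (norm_inclTensor k (ζ k)).le
  refine ⟨∑' k, inclTensor K k (ζ k), fun k => ?_⟩
  rw [(projTensor K k).map_tsum hs,
    tsum_eq_single k fun l hl => projTensor_inclTensor_of_ne hl.symm _, projTensor_inclTensor_self]

end BlockTensors

/-! ### Balanced convex sets in normed spaces -/

section BalancedConvex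

variable {𝕜 X : Type*} [RCLike 𝕜] [NormedAddCommGroup X] [NormedSpace 𝕜 X]

lemma mem_closure_of_forall_norm_le [NormedSpace ℝ X] [IsScalarTower ℝ 𝕜 X] {B : Set X}
    (hconv : Convex ℝ B) (hbal : Balanced 𝕜 B) {x : X}
    (h : ∀ (Λ : StrongDual 𝕜 X) (u : ℝ), (∀ b ∈ B, ‖Λ b‖ ≤ u) → ‖Λ x‖ ≤ u) :
    x ∈ closure B := by
  by_contra hx
  obtain ⟨Λ, u, hBu, hux⟩ := RCLike.geometric_hahn_banach_closed_point (𝕜 := 𝕜)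
    hconv.closure isClosed_closure hx
  refine (hux.trans_le (RCLike.re_le_norm _)).not_ge (h Λ u fun b hb => ?_)
  obtain ⟨c, hc, hcb⟩ := RCLike.exists_norm_eq_mul_self (Λ b)
  have hmem : c • b ∈ B := hbal.smul_mem hc.le hb
  have hre := hBu _ (subset_closure hmem)
  rw [map_smul, smul_eq_mul, ← hcb, RCLike.ofReal_re] at hre
  exact hre.le

variable {Q : Submodule 𝕜 X} {B : Set X} {r : ℝ}

lemma exists_norm_sub_smul_le (hr : 0 < r) (hB : ∀ q ∈ Q, ‖q‖ ≤ 1 → q ∈ closure B)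
    {q : X} (hq : q ∈ Q) : ∃ b ∈ B, ‖q - (‖q‖ : 𝕜) • b‖ ≤ r * ‖q‖ := by
  obtain ⟨b, hb, hqb⟩ := Metric.mem_closure_iff.1
    (hB _ (Q.smul_mem (‖q‖⁻¹ : 𝕜) hq) (by
      rw [norm_smul, norm_inv, RCLike.norm_ofReal, abs_norm]; exact inv_mul_le_one)) r hr
  refine ⟨b, hb, ?_⟩
  rcases eq_or_ne q 0 with rfl | hq0
  · simp
  have hne : (‖q‖ : 𝕜) ≠ 0 := by exact_mod_cast norm_ne_zero_iff.2 hq0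
  calc ‖q - (‖q‖ : 𝕜) • b‖ = ‖(‖q‖ : 𝕜) • ((‖q‖⁻¹ : 𝕜) • q - b)‖ := by
        rw [smul_sub, smul_inv_smul₀ hne]
    _ = ‖q‖ * ‖(‖q‖⁻¹ : 𝕜) • q - b‖ := by rw [norm_smul, RCLike.norm_ofReal, abs_norm]
    _ ≤ ‖q‖ * r := by rw [← dist_eq_norm]; gcongr
    _ = r * ‖q‖ := mul_comm _ _

lemma exists_hasSum_smul (hr : 0 < r) (hr1 : r < 1) (hBQ : B ⊆ Q)
    (hB : ∀ q ∈ Q, ‖q‖ ≤ 1 → q ∈ closure B) {q : X} (hq : q ∈ Q) :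
    ∃ (b : ℕ → X) (c : ℕ → 𝕜),
      (∀ k, b k ∈ B) ∧ (∀ k, ‖c k‖ ≤ r ^ k * ‖q‖) ∧ HasSum (fun k => c k • b k) q := by
  choose! β hβ hβle using fun q (hq : q ∈ Q) => exists_norm_sub_smul_le (𝕜 := 𝕜) hr hB hq
  let ρ : ℕ → X := fun k => (fun p => p - (‖p‖ : 𝕜) • β p)^[k] q
  have hρ : ∀ k, ρ (k + 1) = ρ k - (‖ρ k‖ : 𝕜) • β (ρ k) :=
    fun k => Function.iterate_succ_apply' _ k q
  have hmem : ∀ k, ρ k ∈ Q := fun k => by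
    induction k with
    | zero => exact hq
    | succ k ih => rw [hρ]; exact Q.sub_mem ih (Q.smul_mem _ (hBQ (hβ _ ih)))
  have hnorm : ∀ k, ‖ρ k‖ ≤ r ^ k * ‖q‖ := fun k => by
    induction k with
    | zero => simp [ρ]
    | succ k ih =>
      rw [hρ, pow_succ', mul_assoc]
      exact (hβle _ (hmem k)).trans (by gcongr)
  have hterm : ∀ k, (‖ρ k‖ : 𝕜) • β (ρ k) = ρ k - ρ (k + 1) := fun k => by
    rw [hρ, sub_sub_cancel]
  have hgeom : Summable fun k => r ^ k * ‖q‖ := (summable_geometric_of_lt_one hr.le hr1).mul_right _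
  have hsummable : Summable fun k => ‖ρ k‖ := hgeom.of_nonneg_of_le (fun _ => norm_nonneg _) hnorm
  refine ⟨fun k => β (ρ k), fun k => ‖ρ k‖, fun k => hβ _ (hmem k), fun k => ?_, ?_⟩
  · rw [RCLike.norm_ofReal, abs_norm]
    exact hnorm k
  simp only [hterm]
  rw [hasSum_iff_tendsto_nat_of_summable_norm ((hsummable.add
    ((summable_nat_add_iff 1).2 hsummable)).of_nonneg_of_le (fun _ => norm_nonneg _)
    fun k => norm_sub_le _ _)]
  simp only [Finset.sum_range_sub']
  simpa [ρ] using (squeeze_zero_norm (fun _ => le_rfl) hsummable.tendsto_atTop_zero).const_sub (ρ 0)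

end BalancedConvex

/-! ### The functionals `ω_{a,f}` -/

section Omega

lemma isNormal_vectorFunctional {K : Type*} [NormedAddCommGroup K] [InnerProductSpace ℂ K]
    (N : Subalgebra ℂ (K →L[ℂ] K)) (η ξ : K) :
    IsNormal (vectorFunctional η ξ ∘L N.toSubmodule.subtypeL : N →L[ℂ] ℂ) := by
  let p : L2 ℕ K × L2 ℕ K := (L2.single 0 η, L2.single 0 ξ)
  have hp : (fun T : K →L[ℂ] K => ∑' n, ⟪L2.coord n p.1, T (L2.coord n p.2)⟫_ℂ) =
      vectorFunctional η ξ := by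
    funext T
    rw [tsum_eq_single 0 fun n hn => by simp [p, L2.coord_single, hn]]
    simp [p, L2.coord_single, vectorFunctional_apply]
  have hcont : @Continuous _ _ (ultraweakTopology K) inferInstance (vectorFunctional η ξ) :=
    hp ▸ continuous_iInf_dom (i := p) continuous_induced_dom
  let := ultraweakTopology K
  exact hcont.comp continuous_induced_dom

variable {A G H : Type*} [NonUnitalCStarAlgebra A] [Group G] [NormedAddCommGroup H]
  [InnerProductSpace ℂ H] [CompleteSpace H]

namespace CStarSystem

/-- The von Neumann algebra `(A ⋊_r G)'' ⊗̄ B(ℓ²)`. -/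
abbrev vnAlgebra (D : CStarSystem A G H) :
    Subalgebra ℂ (TensorL2 (L2 G H) →L[ℂ] TensorL2 (L2 G H)) :=
  vnTensor (bicommutant (D.crossedProduct : Set (L2 G H →L[ℂ] L2 G H)))

variable (D : CStarSystem A G H)

lemma norm_omega_le (a : MinTensor D.crossedProduct) (f : D.vnAlgebra →L[ℂ] ℂ) :
    ‖D.omega a f‖ ≤ ‖f‖ * ‖a‖ :=
  LinearMap.mkContinuous_norm_le _ (by positivity) _

/-- `ω_{a,f}` as a bounded linear function of `a`. -/
def omegaCLM (f : D.vnAlgebra →L[ℂ] ℂ) :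
    MinTensor D.crossedProduct →L[ℂ] StrongDual ℂ D.CentralMultiplier :=
  LinearMap.mkContinuous
    { toFun := fun a => D.omega a f
      map_add' := fun a b => by
        ext F
        change f (amplify F.S (a + b)).toVN = f (amplify F.S a).toVN + f (amplify F.S b).toVN
        rw [map_add, MinTensor.toVN_add, map_add]
      map_smul' := fun c a => by
        ext F
        change f (amplify F.S (c • a)).toVN = c • f (amplify F.S a).toVN
        rw [map_smul, MinTensor.toVN_smul, map_smul] }
    ‖f‖ fun a => D.norm_omega_le a f

/-- The functional `F ↦ ⟪η, (S_F ⊗ id)(a) ξ⟫`. -/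
def vectorOmega (a : MinTensor D.crossedProduct) (η ξ : TensorL2 (L2 G H)) :
    StrongDual ℂ D.CentralMultiplier :=
  D.omega a (vectorFunctional η ξ ∘L D.vnAlgebra.toSubmodule.subtypeL)

lemma vectorOmega_apply (a : MinTensor D.crossedProduct) (η ξ : TensorL2 (L2 G H))
    (F : D.CentralMultiplier) : D.vectorOmega a η ξ F = ⟪η, (amplify F.S a).val ξ⟫_ℂ := rfl

lemma norm_vectorOmega_le (a : MinTensor D.crossedProduct) (η ξ : TensorL2 (L2 G H)) :
    ‖D.vectorOmega a η ξ‖ ≤ ‖a‖ * ‖η‖ * ‖ξ‖ := by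
  refine ContinuousLinearMap.opNorm_le_bound _ (by positivity) fun F => ?_
  calc ‖⟪η, (amplify F.S a).val ξ⟫_ℂ‖ ≤ ‖η‖ * (‖amplify F.S a‖ * ‖ξ‖) :=
        (norm_inner_le_norm _ _).trans
          (mul_le_mul_of_nonneg_left ((amplify F.S a).val.le_opNorm ξ) (norm_nonneg η))
    _ ≤ ‖η‖ * (‖F‖ * ‖a‖ * ‖ξ‖) := by gcongr; exact F.isCB_S.bound.norm_amplify_le a
    _ = ‖a‖ * ‖η‖ * ‖ξ‖ * ‖F‖ := by ring

lemma vectorOmega_add_left (a b : MinTensor D.crossedProduct) (η ξ : TensorL2 (L2 G H)) :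
    D.vectorOmega (a + b) η ξ = D.vectorOmega a η ξ + D.vectorOmega b η ξ :=
  map_add (D.omegaCLM _) a b

lemma vectorOmega_smul_left (c : ℂ) (a : MinTensor D.crossedProduct) (η ξ : TensorL2 (L2 G H)) :
    D.vectorOmega (c • a) η ξ = c • D.vectorOmega a η ξ :=
  map_smul (D.omegaCLM _) c a

lemma vectorOmega_ofReal_smul (r : ℝ) (a : MinTensor D.crossedProduct)
    (η ξ : TensorL2 (L2 G H)) :
    D.vectorOmega a ((r : ℂ) • η) ((r : ℂ) • ξ) = (r : ℂ) ^ 2 • D.vectorOmega a η ξ := by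
  ext F
  rw [vectorOmega_apply, map_smul, inner_smul_left, inner_smul_right, Complex.conj_ofReal,
    smul_apply, vectorOmega_apply, smul_eq_mul]
  ring

lemma vectorOmega_blockMin (k : ℕ) (a : MinTensor D.crossedProduct) (η ξ : TensorL2 (L2 G H)) :
    D.vectorOmega (blockMin D.crossedProduct k a) η ξ =
      D.vectorOmega a (projTensor _ k η) (projTensor _ k ξ) := by
  ext F
  rw [vectorOmega_apply, amplify_blockMin F.isCB_S, inner_val_blockMin, vectorOmega_apply]

/-- The functionals `F ↦ ⟪η, (S_F ⊗ id)(a) ξ⟫` with `a`, `η`, `ξ` in the unit balls. -/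
def vectorBall : Set (StrongDual ℂ D.CentralMultiplier) :=
  {ω | ∃ a η ξ, ‖a‖ ≤ 1 ∧ ‖η‖ ≤ 1 ∧ ‖ξ‖ ≤ 1 ∧ ω = D.vectorOmega a η ξ}

lemma norm_le_one_of_mem_vectorBall {ω : StrongDual ℂ D.CentralMultiplier}
    (hω : ω ∈ D.vectorBall) : ‖ω‖ ≤ 1 := by
  obtain ⟨a, η, ξ, ha, hη, hξ, rfl⟩ := hω
  exact (D.norm_vectorOmega_le a η ξ).trans
    (mul_le_one₀ (mul_le_one₀ ha (norm_nonneg _) hη) (norm_nonneg _) hξ)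

lemma balanced_vectorBall : Balanced ℂ D.vectorBall :=
  balanced_iff_smul_mem.2 fun {c} hc {ω} hω => by
    obtain ⟨a, η, ξ, ha, hη, hξ, rfl⟩ := hω
    exact ⟨c • a, η, ξ, (norm_smul c a).trans_le (mul_le_one₀ hc (norm_nonneg _) ha), hη, hξ,
      (D.vectorOmega_smul_left c a η ξ).symm⟩

lemma convex_vectorBall : Convex ℝ D.vectorBall := by
  rintro _ ⟨a, η, ξ, ha, hη, hξ, rfl⟩ _ ⟨a', η', ξ', ha', hη', hξ', rfl⟩ s t hs ht hst
  refine ⟨blockMin _ 0 a + blockMin _ 1 a',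
    inclTensor _ 0 ((√s : ℂ) • η) + inclTensor _ 1 ((√t : ℂ) • η'),
    inclTensor _ 0 ((√s : ℂ) • ξ) + inclTensor _ 1 ((√t : ℂ) • ξ'),
    norm_blockMin_add_le zero_ne_one zero_le_one ha ha',
    norm_inclTensor_sqrt_smul_add_le zero_ne_one hη hη' hs ht hst,
    norm_inclTensor_sqrt_smul_add_le zero_ne_one hξ hξ' hs ht hst, ?_⟩
  have hsqrt {r : ℝ} (hr : 0 ≤ r) (ω : StrongDual ℂ D.CentralMultiplier) :
      (√r : ℂ) ^ 2 • ω = r • ω := by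
    rw [← Complex.ofReal_pow, Real.sq_sqrt hr]
    rfl
  rw [vectorOmega_add_left, vectorOmega_blockMin, vectorOmega_blockMin]
  simp only [map_add, projTensor_inclTensor_self, projTensor_inclTensor_of_ne zero_ne_one,
    projTensor_inclTensor_of_ne one_ne_zero, add_zero, zero_add, vectorOmega_ofReal_smul,
    hsqrt hs, hsqrt ht]

lemma norm_le_of_forall_vectorBall {F : D.CentralMultiplier} {M : ℝ} (hM : 0 ≤ M)
    (h : ∀ ω ∈ D.vectorBall, ‖ω F‖ ≤ M) : ‖F‖ ≤ M := by
  rw [CentralMultiplier.norm_def, cbNorm_eq_norm_amplify F.isCB_S]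
  exact ContinuousLinearMap.opNorm_le_of_unit_norm hM fun a ha =>
    norm_le_of_norm_inner_le hM fun η ξ hη hξ => h _ ⟨a, η, ξ, ha.le, hη.le, hξ.le, rfl⟩

lemma exists_eq_vectorOmega_of_hasSum {ω : ℕ → StrongDual ℂ D.CentralMultiplier}
    (hω : ∀ k, ω k ∈ D.vectorBall) {c : ℕ → ℂ} {C : ℝ} (hc : ∀ k, ‖c k‖ ≤ 8⁻¹ ^ k * C)
    {q : StrongDual ℂ D.CentralMultiplier} (hq : HasSum (fun k => c k • ω k) q) :
    ∃ a η ξ, q = D.vectorOmega a η ξ := by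
  choose a η ξ ha hη hξ hω using hω
  -- Writing `c_k = (4^k c_k) 2^{-k} 2^{-k}`, the first factor goes to `a_k` and one factor `2^{-k}`
  -- to each of `η_k` and `ξ_k`, so that all three block sums converge in norm.
  have hgeom : Summable fun k : ℕ => (2⁻¹ : ℝ) ^ k :=
    summable_geometric_of_lt_one (by norm_num) (by norm_num)
  have hblock (ζ : ℕ → TensorL2 (L2 G H)) (hζ : ∀ k, ‖ζ k‖ ≤ 1) :
      ∃ ζ', ∀ k, projTensor _ k ζ' = ((2⁻¹ ^ k : ℝ) : ℂ) • ζ k :=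
    exists_forall_projTensor_eq <| hgeom.of_nonneg_of_le (fun _ => norm_nonneg _) fun k => by
      rw [norm_smul, Complex.norm_real, norm_pow, norm_inv, Real.norm_ofNat]
      exact mul_le_of_le_one_right (by positivity) (hζ k)
  obtain ⟨η', hη'⟩ := hblock η hη
  obtain ⟨ξ', hξ'⟩ := hblock ξ hξ
  have hsum : Summable fun k => (4 ^ k * c k) • blockMin D.crossedProduct k (a k) :=
    (hgeom.mul_right C).of_norm_bounded fun k => by
      calc ‖(4 ^ k * c k) • blockMin D.crossedProduct k (a k)‖
          ≤ 4 ^ k * ‖c k‖ := by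
            rw [norm_smul, norm_mul, norm_pow, Complex.norm_ofNat]
            exact mul_le_of_le_one_right (by positivity) ((norm_blockMin_le k _).trans (ha k))
        _ ≤ 4 ^ k * (8⁻¹ ^ k * C) := by gcongr; exact hc k
        _ = 2⁻¹ ^ k * C := by rw [← mul_assoc, ← mul_pow]; norm_num
  refine ⟨∑' k, (4 ^ k * c k) • blockMin D.crossedProduct k (a k), η', ξ', hq.unique ?_⟩
  refine (hsum.hasSum.mapL (D.omegaCLM _)).congr_fun fun k => ?_
  have hscalar : 4 ^ k * c k * ((2⁻¹ ^ k : ℝ) : ℂ) ^ 2 = c k := by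
    have : (4 : ℂ) ^ k * ((2⁻¹ : ℂ) ^ k) ^ 2 = 1 := by
      rw [pow_right_comm, ← mul_pow]; norm_num
    push_cast
    linear_combination c k * this
  calc c k • ω k = (4 ^ k * c k) • D.vectorOmega (blockMin D.crossedProduct k (a k)) η' ξ' := by
        rw [vectorOmega_blockMin, hη', hξ', vectorOmega_ofReal_smul, smul_smul, hscalar, hω]
    _ = _ := (D.vectorOmega_smul_left _ _ _ _).symm

end CStarSystem

end Omega

/-! ### The predual -/

section Predual

variable {Z G H : Type*} [TopologicalSpace Z] [DiscreteTopology Z] [Group G]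
  [NormedAddCommGroup H] [InnerProductSpace ℂ H] [CompleteSpace H]
  (D : CStarSystem C₀(Z, ℂ) G H)

lemma omega_tmulMin_coeff_delta (b : CompactL2) (s : G) (z : Z) (f : D.vnAlgebra →L[ℂ] ℂ) :
    D.omega (tmulMin D.crossedProduct b (D.coeff s (delta z))) f =
      f (tmulMin D.crossedProduct b (D.coeff s (delta z))).toVN • evalAt D (z, s) := by
  ext F
  change f (amplify F.S (tmulMin D.crossedProduct b (D.coeff s (delta z)))).toVN = _
  rw [amplify_tmulMin F.isCB_S, F.S_coeff_delta, map_smul, MinTensor.toVN_smul, map_smul,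
    smul_eq_mul, mul_comm]
  rfl

lemma omega_mem_topologicalClosure (a : MinTensor D.crossedProduct) (f : D.vnAlgebra →L[ℂ] ℂ) :
    D.omega a f ∈ (LinearMap.range (pairing D)).topologicalClosure := by
  let S := (LinearMap.range (pairing D)).topologicalClosure.comap (D.omegaCLM f).toLinearMap
  have hS : IsClosed (S : Set (MinTensor D.crossedProduct)) :=
    (Submodule.isClosed_topologicalClosure _).preimage (D.omegaCLM f).continuous
  refine mem_of_tmulMin_mem hS (fun b => mem_of_coeff_delta_mem
    (S := S.comap (tmulMin D.crossedProduct b).toLinearMap)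
    (hS.preimage (tmulMin D.crossedProduct b).continuous) fun s z => ?_) a
  change D.omega (tmulMin D.crossedProduct b (D.coeff s (delta z))) f ∈
    (LinearMap.range (pairing D)).topologicalClosure
  rw [omega_tmulMin_coeff_delta, pairing, Finsupp.range_linearCombination]
  exact Submodule.le_topologicalClosure _
    (Submodule.smul_mem _ _ (Submodule.subset_span (Set.mem_range_self _)))

lemma vectorBall_subset_topologicalClosure :
    D.vectorBall ⊆ (LinearMap.range (pairing D)).topologicalClosure := by
  rintro _ ⟨a, η, ξ, -, -, -, rfl⟩
  exact omega_mem_topologicalClosure D a _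

lemma mem_closure_vectorBall {q : StrongDual ℂ D.CentralMultiplier}
    (hq : q ∈ (LinearMap.range (pairing D)).topologicalClosure) (hq1 : ‖q‖ ≤ 1) :
    q ∈ closure D.vectorBall := by
  refine mem_closure_of_forall_norm_le D.convex_vectorBall D.balanced_vectorBall fun Λ u hu => ?_
  obtain ⟨F, hF⟩ := exists_multiplier_eq_on_Qcent D Λ
  have hu0 : 0 ≤ u := (norm_nonneg _).trans
    (hu 0 ⟨0, 0, 0, by simp, by simp, by simp, (map_zero (D.omegaCLM _)).symm⟩)
  have hFu : ‖F‖ ≤ u := D.norm_le_of_forall_vectorBall hu0 fun ω hω => by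
    rw [← hF ω (vectorBall_subset_topologicalClosure D hω)]
    exact hu ω hω
  rw [hF q hq]
  exact (q.le_of_opNorm_le hq1 F).trans ((one_mul _).trans_le hFu)

lemma exists_eq_vectorOmega {q : StrongDual ℂ D.CentralMultiplier}
    (hq : q ∈ (LinearMap.range (pairing D)).topologicalClosure) :
    ∃ a η ξ, q = D.vectorOmega a η ξ := by
  obtain ⟨ω, c, hω, hc, hsum⟩ := exists_hasSum_smul (r := 8⁻¹) (by norm_num) (by norm_num)
    (vectorBall_subset_topologicalClosure D) (fun _ => mem_closure_vectorBall D) hq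
  exact D.exists_eq_vectorOmega_of_hasSum hω hc hsum

lemma range_toDual : Set.range (Qcent.toDual D) =
    ((LinearMap.range (pairing D)).topologicalClosure : Set (StrongDual ℂ D.CentralMultiplier)) :=
  Subtype.range_coe

lemma norm_flip_toDual (F : D.CentralMultiplier) : ‖(Qcent.toDual D).flip F‖ = ‖F‖ := by
  refine le_antisymm (ContinuousLinearMap.opNorm_le_bound _ (norm_nonneg _) fun q => ?_) ?_
  · exact ((Qcent.toDual D q).le_opNorm F).trans_eq (mul_comm _ _)
  · refine D.norm_le_of_forall_vectorBall (norm_nonneg _) fun ω hω => ?_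
    let q : Qcent D := ⟨ω, vectorBall_subset_topologicalClosure D hω⟩
    have hq : ‖q‖ ≤ 1 := D.norm_le_one_of_mem_vectorBall hω
    exact ((Qcent.toDual D).flip F).unit_le_opNorm q hq

lemma surjective_flip_toDual : Function.Surjective (Qcent.toDual D).flip := fun Λ => by
  obtain ⟨Λ', hΛ', -⟩ := exists_extension_norm_eq
    (LinearMap.range (pairing D)).topologicalClosure Λ
  obtain ⟨F, hF⟩ := exists_multiplier_eq_on_Qcent D Λ'
  refine ⟨F, ContinuousLinearMap.ext fun q => ?_⟩
  exact (hF _ q.2).symm.trans (hΛ' q)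

end Predual

end HerzSchur
end

theorem proposition4p7 {Z G H : Type*} [TopologicalSpace Z] [DiscreteTopology Z] [Group G]
    [NormedAddCommGroup H] [InnerProductSpace ℂ H] [CompleteSpace H]
    (D : CStarSystem C₀(Z, ℂ) G H) :
    (∃ J : D.CentralMultiplier ≃ₗᵢ[ℂ] StrongDual ℂ (Qcent D),
      ∀ (F : D.CentralMultiplier) (q : Qcent D), J F q = Qcent.toDual D q F) ∧
    Set.range (Qcent.toDual D) =
      {ω | ∃ (a : MinTensor D.crossedProduct)
        (f : vnTensor (bicommutant (D.crossedProduct : Set (L2 G H →L[ℂ] L2 G H))) →L[ℂ] ℂ),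
        IsNormal f ∧ ω = D.omega a f} := by
  refine ⟨⟨LinearIsometryEquiv.ofSurjective ⟨(Qcent.toDual D).flip.toLinearMap, norm_flip_toDual D⟩
    (surjective_flip_toDual D), fun _ _ => rfl⟩, ?_⟩
  rw [range_toDual]
  ext ω
  constructor
  · intro hω
    obtain ⟨a, η, ξ, rfl⟩ := exists_eq_vectorOmega D hω
    exact ⟨a, _, isNormal_vectorFunctional _ η ξ, rfl⟩
  · rintro ⟨a, f, -, rfl⟩
    exact omega_mem_topologicalClosure D a f
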